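/- Let $n,p$ be integers with $n-p-1>0$, let $M\in\mathbb{R}^{n\times p}$, and let $X\in\mathbb{R}^{n\times p}$ be a random matrix whose entries are independent Gaussian random variables $X_{ij}\sim \mathrm{N}(M_{ij},1)$. Let $\hat M_{\mathrm{EM}}=X\bigl(I_p-(n-p-1)(X^\top X)^{-1}\bigr)$ be the Efron--Morris estimator of $M$ (the matrix $X^\top X$ is almost surely invertible), and let $\hat M_{C_*}=XC_*$ be the linear oracle, where $C_*=C_*(M)=(M^\top M+nI_p)^{-1}M^\top M$. Then, for every symmetric positive definite matrix $Q\in\mathbb{R}^{p\times p}$, the losses below have finite expectation and $$\mathrm{E}_M\bigl[\operatorname{tr}\bigl((\hat M_{\mathrm{EM}}-M)\,Q\,(\hat M_{\mathrm{EM}}-M)^\top\bigr)\bigr]\le \mathrm{E}_M\bigl[\operatorname{tr}\bigl((\hat M_{C_*}-M)\,Q\,(\hat M_{C_*}-M)^\top\bigr)\bigr]+2(p+1)\operatorname{tr}(Q).$$ -/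

import Mathlib

open MeasureTheory ProbabilityTheory
open scoped Matrix

/-- `X` is a random `n × p` matrix on `(Ω, P)` whose entries are independent Gaussian random
variables `X i j ∼ N(M i j, 1)`. -/
structure IsGaussianMatrix {Ω : Type*} [MeasurableSpace Ω] {n p : ℕ}
    (X : Ω → Matrix (Fin n) (Fin p) ℝ) (M : Matrix (Fin n) (Fin p) ℝ) (P : Measure Ω) : Prop where
  hasLaw_entry : ∀ i j, HasLaw (fun ω => X ω i j) (gaussianReal (M i j) 1) P
  indep_entries : iIndepFun (fun (ij : Fin n × Fin p) (ω : Ω) => X ω ij.1 ij.2) P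

/-- The Efron–Morris estimator `X (I - (n - p - 1) (Xᵀ X)⁻¹)`. -/
noncomputable def efronMorris {n p : ℕ} (X : Matrix (Fin n) (Fin p) ℝ) :
    Matrix (Fin n) (Fin p) ℝ :=
  X * (1 - ((n : ℝ) - (p : ℝ) - 1) • (Xᵀ * X)⁻¹)

/-- The linear estimator `X C`. -/
def linearEstimator {n p : ℕ} (C : Matrix (Fin p) (Fin p) ℝ) (X : Matrix (Fin n) (Fin p) ℝ) :
    Matrix (Fin n) (Fin p) ℝ :=
  X * C

/-- The coefficient matrix `C_*(M) = (Mᵀ M + n I)⁻¹ Mᵀ M` of the linear oracle. -/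
noncomputable def oracleCoeff {n p : ℕ} (M : Matrix (Fin n) (Fin p) ℝ) :
    Matrix (Fin p) (Fin p) ℝ :=
  (Mᵀ * M + (n : ℝ) • (1 : Matrix (Fin p) (Fin p) ℝ))⁻¹ * (Mᵀ * M)

/-- The quadratic loss `tr ((M̂ - M) Q (M̂ - M)ᵀ)`. -/
def quadraticLoss {n p : ℕ} (Q : Matrix (Fin p) (Fin p) ℝ) (M Mhat : Matrix (Fin n) (Fin p) ℝ) :
    ℝ :=
  ((Mhat - M) * Q * (Mhat - M)ᵀ).trace

/-! Write `S = Xᵀ X`, `c = n - p - 1` and `B = (Mᵀ M + n I)⁻¹`. Both risks are compared with `n tr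
Q`. Expanding the Efron–Morris loss leaves a cross term between `X - M` and `X S⁻¹`. Stein's
identity turns its expectation into a divergence, which gives risk at most `n tr Q - c² E tr(Q
S⁻¹)`. Since `E S = B⁻¹`, operator convexity of the inverse gives `E tr(Q S⁻¹) ≥ tr(Q B)`. The
oracle coefficient is `I - n B`, and its variance and squared bias add up to `n tr Q - n² tr(Q B)`.
The excess risk is thus at most `(n² - c²) tr(Q B) ≤ 2 (p + 1) n tr(Q B) ≤ 2 (p + 1) tr Q`, the last
step because `n B ≤ I`.

The analytic difficulty is that `S⁻¹` is unbounded and may fail to exist. Everything is done first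
for `ridgeInv ε X`, for which the Stein functions and their derivatives are bounded, and where the
divergence is only bounded below (`trace_mul_ridgeInv_le_divergence`). The same inequality with `Q =
I` bounds `E tr (ridgeInv ε X)` uniformly in `ε`. Fatou's lemma then yields both almost sure
invertibility of `S` and integrability of `S⁻¹`, and dominated convergence lets `ε → 0`
(`integral_trace_inv_gram_le`). -/

/-! ### Stein's identity, from one Gaussian variable to a Gaussian matrix. -/

theorem hasDerivAt_gaussianPDFReal_one (m x : ℝ) :
    HasDerivAt (gaussianPDFReal m 1) (-((x - m) * gaussianPDFReal m 1 x)) x := by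
  unfold gaussianPDFReal
  have h : HasDerivAt (fun x : ℝ => -(x - m) ^ 2 / (2 * ((1 : NNReal) : ℝ))) (-(x - m)) x := by
    have := (((hasDerivAt_id' x).sub_const m).pow 2).neg.div_const (2 * ((1 : NNReal) : ℝ))
    refine this.congr_deriv ?_
    simp only [NNReal.coe_one]
    ring
  refine (h.exp.const_mul (√(2 * Real.pi * ((1 : NNReal) : ℝ)))⁻¹).congr_deriv ?_
  ring

theorem integrable_gaussianPDFReal_mul {m : ℝ} {f : ℝ → ℝ}
    (hf : Integrable f (gaussianReal m 1)) :
    Integrable (fun x => gaussianPDFReal m 1 x * f x) := by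
  rw [gaussianReal_of_var_ne_zero _ one_ne_zero,
    integrable_withDensity_iff_integrable_smul' (measurable_gaussianPDF m 1)
      (ae_of_all _ fun _ => gaussianPDF_lt_top)] at hf
  simpa [toReal_gaussianPDF] using hf

theorem integrable_sub_mul_gaussianReal {m C : ℝ} {f : ℝ → ℝ} (hf : Measurable f)
    (hC : ∀ x, |f x| ≤ C) : Integrable (fun x => (x - m) * f x) (gaussianReal m 1) := by
  have h1 : Integrable (fun x : ℝ => x - m) (gaussianReal m 1) :=
    ((memLp_id_gaussianReal 1).integrable (by simp)).sub (integrable_const _)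
  exact h1.mul_bdd hf.aestronglyMeasurable (ae_of_all _ fun x => hC x)

/-- Stein's identity for a one-dimensional Gaussian of unit variance. -/
theorem integral_sub_mul_gaussianReal {m C : ℝ} {f f' : ℝ → ℝ}
    (hf : ∀ x, HasDerivAt f (f' x) x) (hC : ∀ x, |f x| ≤ C) (hC' : ∀ x, |f' x| ≤ C) :
    ∫ x, (x - m) * f x ∂gaussianReal m 1 = ∫ x, f' x ∂gaussianReal m 1 := by
  have hfm : Measurable f :=
    (continuous_iff_continuousAt.2 fun x => (hf x).continuousAt).measurable
  have hf'm : Measurable f' := by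
    have : f' = deriv f := funext fun x => (hf x).deriv.symm
    rw [this]; exact measurable_deriv f
  have h0 : Integrable f (gaussianReal m 1) :=
    .of_bound hfm.aestronglyMeasurable C (ae_of_all _ hC)
  have h1 : Integrable f' (gaussianReal m 1) :=
    .of_bound hf'm.aestronglyMeasurable C (ae_of_all _ hC')
  have h2 := integrable_sub_mul_gaussianReal (m := m) hfm hC
  -- Integration by parts on the line: the density `φ` satisfies `φ' = -(x - m) φ`.
  have key := integral_mul_deriv_eq_deriv_mul_of_integrable (u := gaussianPDFReal m 1) (v := f)
    (fun x _ => hasDerivAt_gaussianPDFReal_one m x) (fun x _ => hf x)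
    (integrable_gaussianPDFReal_mul h1)
    ((integrable_gaussianPDFReal_mul h2).neg.congr (ae_of_all _ fun x => by simp; ring))
    (integrable_gaussianPDFReal_mul h0)
  rw [integral_gaussianReal_eq_integral_smul one_ne_zero,
    integral_gaussianReal_eq_integral_smul one_ne_zero]
  simp only [smul_eq_mul]
  rw [key, ← integral_neg]
  exact integral_congr_ae (ae_of_all _ fun x => by simp; ring)

/-- Resampling one coordinate of a product probability measure does not change it. -/
theorem measurePreserving_update {ι : Type*} [Fintype ι] [DecidableEq ι] (μ : ι → Measure ℝ)
    [∀ i, IsProbabilityMeasure (μ i)] (i : ι) :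
    MeasurePreserving (fun z : (ι → ℝ) × ℝ => Function.update z.1 i z.2)
      ((Measure.pi μ).prod (μ i)) (Measure.pi μ) := by
  have hm : Measurable (fun z : (ι → ℝ) × ℝ => Function.update z.1 i z.2) := by
    refine measurable_pi_lambda _ fun j => ?_
    rcases eq_or_ne j i with rfl | hj
    · simpa using measurable_snd
    · simp only [Function.update_of_ne hj]
      fun_prop
  refine ⟨hm, (Measure.pi_eq fun s hs => ?_).symm⟩
  rw [Measure.map_apply hm (MeasurableSet.univ_pi hs)]
  have : (fun z : (ι → ℝ) × ℝ => Function.update z.1 i z.2) ⁻¹' Set.univ.pi s =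
      (Set.univ.pi (Function.update s i Set.univ)) ×ˢ s i := by
    ext ⟨x, y⟩
    simp only [Set.mem_preimage, Set.mem_pi, Set.mem_univ, true_imp_iff, Set.mem_prod]
    constructor
    · intro h
      refine ⟨fun j => ?_, by simpa using h i⟩
      rcases eq_or_ne j i with rfl | hj
      · simp
      · simpa [Function.update_of_ne hj] using h j
    · rintro ⟨h, hy⟩ j
      rcases eq_or_ne j i with rfl | hj
      · simpa using hy
      · simpa [Function.update_of_ne hj] using h j
  rw [this, Measure.prod_prod, Measure.pi_pi, ← Finset.mul_prod_erase _ _ (Finset.mem_univ i),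
    ← Finset.mul_prod_erase _ (fun j => μ j (s j)) (Finset.mem_univ i), mul_comm]
  simp only [Function.update_self, measure_univ, one_mul]
  congr 1
  exact Finset.prod_congr rfl fun j hj => by rw [Function.update_of_ne (Finset.ne_of_mem_erase hj)]

/-- Stein's identity in one coordinate of a product of Gaussians of unit variance. -/
theorem integral_sub_mul_pi_gaussianReal {ι : Type*} [Fintype ι] [DecidableEq ι] (m : ι → ℝ)
    (i : ι) {C : ℝ} {f f' : (ι → ℝ) → ℝ} (hfm : Measurable f) (hfm' : Measurable f')
    (hf : ∀ x, HasDerivAt (fun t => f (Function.update x i t)) (f' x) (x i))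
    (hC : ∀ x, |f x| ≤ C) (hC' : ∀ x, |f' x| ≤ C) :
    ∫ x, (x i - m i) * f x ∂Measure.pi (fun j => gaussianReal (m j) 1) =
      ∫ x, f' x ∂Measure.pi (fun j => gaussianReal (m j) 1) := by
  have hmp := measurePreserving_update (fun j => gaussianReal (m j) 1) i
  have h1 : Integrable (fun x : ι → ℝ => (x i - m i) * f x)
      (Measure.pi (fun j => gaussianReal (m j) 1)) := by
    have h : Integrable (fun x : ι → ℝ => x i - m i)
        (Measure.pi (fun j => gaussianReal (m j) 1)) :=
      (measurePreserving_eval (fun j => gaussianReal (m j) 1) i).integrable_comp_of_integrable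
        (g := fun y => y - m i)
        (((memLp_id_gaussianReal 1).integrable (by simp)).sub (integrable_const _))
    exact h.mul_bdd hfm.aestronglyMeasurable (ae_of_all _ fun x => hC x)
  have h2 : Integrable f' (Measure.pi (fun j => gaussianReal (m j) 1)) :=
    .of_bound hfm'.aestronglyMeasurable C (ae_of_all _ hC')
  have e1 : Integrable (fun z : (ι → ℝ) × ℝ => (Function.update z.1 i z.2 i - m i) *
      f (Function.update z.1 i z.2)) _ := hmp.integrable_comp_of_integrable h1
  have e2 : Integrable (fun z : (ι → ℝ) × ℝ => f' (Function.update z.1 i z.2)) _ := hmp.integrable_comp_of_integrable h2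
  -- Resampling coordinate `i` on both sides makes the inner Fubini integral a one-dimensional Stein
  -- identity with the other coordinates frozen.
  conv_lhs => rw [← hmp.map_eq]
  conv_rhs => rw [← hmp.map_eq]
  rw [integral_map hmp.measurable.aemeasurable (by rw [hmp.map_eq]; exact h1.1),
    integral_map hmp.measurable.aemeasurable (by rw [hmp.map_eq]; exact h2.1),
    integral_prod _ e1, integral_prod _ e2]
  refine integral_congr_ae (ae_of_all _ fun x => ?_)
  simp only [Function.update_self]
  refine integral_sub_mul_gaussianReal (C := C) (fun y => ?_) (fun y => hC _) (fun y => hC' _)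
  simpa using hf (Function.update x i y)

theorem IsGaussianMatrix.hasLaw_pi {Ω : Type*} [MeasurableSpace Ω] {P : Measure Ω}
    [IsProbabilityMeasure P] {n p : ℕ} {X : Ω → Matrix (Fin n) (Fin p) ℝ}
    {M : Matrix (Fin n) (Fin p) ℝ} (hX : IsGaussianMatrix X M P) :
    HasLaw (fun ω (ij : Fin n × Fin p) => X ω ij.1 ij.2)
      (Measure.pi fun ij : Fin n × Fin p => gaussianReal (M ij.1 ij.2) 1) P :=
  hX.indep_entries.hasLaw_pi fun ij => hX.hasLaw_entry ij.1 ij.2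

/-- Stein's identity in one entry of a Gaussian matrix. -/
theorem IsGaussianMatrix.integral_sub_mul {Ω : Type*} [MeasurableSpace Ω] {P : Measure Ω}
    [IsProbabilityMeasure P] {n p : ℕ} {X : Ω → Matrix (Fin n) (Fin p) ℝ}
    {M : Matrix (Fin n) (Fin p) ℝ} (hX : IsGaussianMatrix X M P) (i : Fin n) (j : Fin p)
    {C : ℝ} {f f' : Matrix (Fin n) (Fin p) ℝ → ℝ} (hfm : Continuous f) (hfm' : Continuous f')
    (hf : ∀ x, HasDerivAt (fun t : ℝ => f (x + t • Matrix.single i j 1)) (f' x) 0)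
    (hC : ∀ x, |f x| ≤ C) (hC' : ∀ x, |f' x| ≤ C) :
    ∫ ω, (X ω i j - M i j) * f (X ω) ∂P = ∫ ω, f' (X ω) ∂P := by
  let e : (Fin n × Fin p → ℝ) → Matrix (Fin n) (Fin p) ℝ := fun x => Matrix.of fun i j => x (i, j)
  have he : Continuous e := continuous_matrix fun i j => continuous_apply _
  have hm : Measurable (fun x => f (e x)) := (hfm.comp he).measurable
  have hm' : Measurable (fun x => f' (e x)) := (hfm'.comp he).measurable
  have key := integral_sub_mul_pi_gaussianReal (fun ij : Fin n × Fin p => M ij.1 ij.2) (i, j)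
    (C := C) hm hm' (fun x => ?_) (fun x => hC _) (fun x => hC' _)
  · have l1 := hX.hasLaw_pi.integral_comp (f := fun x => (x (i, j) - M i j) * f (e x))
      ((((measurable_pi_apply (i, j)).sub_const _).mul hm).aestronglyMeasurable)
    have l2 := hX.hasLaw_pi.integral_comp (f := fun x => f' (e x)) hm'.aestronglyMeasurable
    exact l1.trans (key.trans l2.symm)
  · have h0 := hf (e x)
    -- Setting an entry to `t` amounts to adding `t - x (i, j)` to it; this shift links
    -- `Function.update` to the derivative at `0` in `hf`.
    have h1 : HasDerivAt (fun t : ℝ => t - x (i, j)) 1 (x (i, j)) :=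
      (hasDerivAt_id _).sub_const _
    have h2 := HasDerivAt.comp (x (i, j)) (h₂ := fun t : ℝ => f (e x + t • Matrix.single i j 1))
      (h := fun t : ℝ => t - x (i, j)) (by simpa using h0) h1
    rw [mul_one] at h2
    refine h2.congr_of_eventuallyEq (Filter.Eventually.of_forall fun t => ?_)
    simp only [Function.comp]
    congr 1
    ext a b
    by_cases hab : (a, b) = (i, j)
    · obtain ⟨rfl, rfl⟩ := Prod.mk.inj hab
      simp [e]
    · have : ¬ (i = a ∧ j = b) := fun h => hab (by rw [h.1, h.2])
      simp [e, Function.update_of_ne hab, this]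

open Filter Topology

/-! ### Algebra and bounds for the regularized inverse Gram matrix. -/

section RidgeInverse

variable {n p : ℕ}

/-- The regularized inverse Gram matrix `(Xᵀ X + ε I)⁻¹`. -/
noncomputable def ridgeInv (ε : ℝ) (X : Matrix (Fin n) (Fin p) ℝ) : Matrix (Fin p) (Fin p) ℝ :=
  (Xᵀ * X + ε • (1 : Matrix (Fin p) (Fin p) ℝ))⁻¹

theorem isUnit_det_gram_add_smul_one {ε : ℝ} (hε : 0 < ε) (X : Matrix (Fin n) (Fin p) ℝ) :
    IsUnit (Xᵀ * X + ε • (1 : Matrix (Fin p) (Fin p) ℝ)).det := by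
  have h1 : (Xᵀ * X).PosSemidef := by
    simpa using Matrix.posSemidef_conjTranspose_mul_self X
  have h2 : (ε • (1 : Matrix (Fin p) (Fin p) ℝ)).PosDef := Matrix.PosDef.one.smul hε
  exact (Matrix.isUnit_iff_isUnit_det _).1 (h2.posSemidef_add h1).isUnit

theorem transpose_ridgeInv (ε : ℝ) (X : Matrix (Fin n) (Fin p) ℝ) :
    (ridgeInv ε X)ᵀ = ridgeInv ε X := by
  rw [ridgeInv, Matrix.transpose_nonsing_inv]
  simp

theorem gram_mul_ridgeInv {ε : ℝ} (hε : 0 < ε) (X : Matrix (Fin n) (Fin p) ℝ) :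
    Xᵀ * X * ridgeInv ε X = 1 - ε • ridgeInv ε X := by
  have h := Matrix.mul_nonsing_inv _ (isUnit_det_gram_add_smul_one hε X)
  rw [← ridgeInv, Matrix.add_mul, Matrix.smul_mul, Matrix.one_mul] at h
  exact eq_sub_of_add_eq h

/-- With `G = ridgeInv ε X`, this splits `G` into the Gram matrices `(X G)ᵀ (X G)` and `ε G²`.
Reading off diagonals or traces gives almost all the bounds below. -/
theorem ridgeInv_mul_gram_mul {ε : ℝ} (hε : 0 < ε) (X : Matrix (Fin n) (Fin p) ℝ) :
    (X * ridgeInv ε X)ᵀ * (X * ridgeInv ε X) =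
      ridgeInv ε X - ε • (ridgeInv ε X * ridgeInv ε X) := by
  rw [Matrix.transpose_mul, transpose_ridgeInv, Matrix.mul_assoc, ← Matrix.mul_assoc Xᵀ,
    gram_mul_ridgeInv hε, Matrix.mul_sub, Matrix.mul_one, Matrix.mul_smul]

theorem transpose_mul_self_apply_self (Y : Matrix (Fin n) (Fin p) ℝ) (k : Fin p) :
    (Yᵀ * Y) k k = ∑ i, Y i k ^ 2 := by
  simp [Matrix.mul_apply, sq]

theorem sq_apply_le_transpose_mul_self (Y : Matrix (Fin n) (Fin p) ℝ) (i : Fin n) (k : Fin p) :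
    Y i k ^ 2 ≤ (Yᵀ * Y) k k := by
  rw [transpose_mul_self_apply_self]
  exact Finset.single_le_sum (f := fun i => Y i k ^ 2) (fun i _ => sq_nonneg _) (Finset.mem_univ i)

theorem transpose_mul_self_apply_self_nonneg (Y : Matrix (Fin n) (Fin p) ℝ) (k : Fin p) :
    0 ≤ (Yᵀ * Y) k k := by
  rw [transpose_mul_self_apply_self]
  exact Finset.sum_nonneg fun i _ => sq_nonneg _

theorem abs_transpose_mul_self_le (Y : Matrix (Fin n) (Fin p) ℝ) (j k : Fin p) :
    |(Yᵀ * Y) j k| ≤ (Yᵀ * Y) j j + (Yᵀ * Y) k k := by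
  rw [transpose_mul_self_apply_self, transpose_mul_self_apply_self, ← Finset.sum_add_distrib,
    Matrix.mul_apply]
  refine (Finset.abs_sum_le_sum_abs _ _).trans (Finset.sum_le_sum fun i _ => ?_)
  rw [Matrix.transpose_apply, abs_le]
  constructor <;> nlinarith [sq_nonneg (Y i j + Y i k), sq_nonneg (Y i j - Y i k)]

theorem trace_mul_transpose_mul_self_nonneg {Q : Matrix (Fin p) (Fin p) ℝ} (hQ : Q.PosSemidef)
    {m : ℕ} (Y : Matrix (Fin m) (Fin p) ℝ) : 0 ≤ (Q * (Yᵀ * Y)).trace := by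
  have h := (hQ.mul_mul_conjTranspose_same Y).trace_nonneg
  rwa [Matrix.conjTranspose_eq_transpose_of_trivial, Matrix.mul_assoc, Matrix.trace_mul_comm,
    Matrix.mul_assoc] at h

theorem ridgeInv_apply_self {ε : ℝ} (hε : 0 < ε) (X : Matrix (Fin n) (Fin p) ℝ) (k : Fin p) :
    ridgeInv ε X k k = ε * ∑ j, ridgeInv ε X j k ^ 2 + ∑ i, (X * ridgeInv ε X) i k ^ 2 := by
  rw [← transpose_mul_self_apply_self, ← transpose_mul_self_apply_self, ridgeInv_mul_gram_mul hε,
    transpose_ridgeInv]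
  simp

theorem ridgeInv_apply_self_nonneg {ε : ℝ} (hε : 0 < ε) (X : Matrix (Fin n) (Fin p) ℝ)
    (k : Fin p) : 0 ≤ ridgeInv ε X k k := by
  rw [ridgeInv_apply_self hε]
  positivity

theorem sq_mul_ridgeInv_apply_le {ε : ℝ} (hε : 0 < ε) (X : Matrix (Fin n) (Fin p) ℝ)
    (i : Fin n) (k : Fin p) : (X * ridgeInv ε X) i k ^ 2 ≤ ridgeInv ε X k k := by
  rw [ridgeInv_apply_self hε]
  have h := Finset.single_le_sum (f := fun i => (X * ridgeInv ε X) i k ^ 2)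
    (fun i _ => sq_nonneg _) (Finset.mem_univ i)
  have : 0 ≤ ε * ∑ j, ridgeInv ε X j k ^ 2 := by positivity
  linarith

theorem mul_sq_ridgeInv_apply_le {ε : ℝ} (hε : 0 < ε) (X : Matrix (Fin n) (Fin p) ℝ)
    (j k : Fin p) : ε * ridgeInv ε X j k ^ 2 ≤ ridgeInv ε X k k := by
  rw [ridgeInv_apply_self hε X k]
  have h := Finset.single_le_sum (f := fun j => ridgeInv ε X j k ^ 2)
    (fun i _ => sq_nonneg _) (Finset.mem_univ j)
  have : 0 ≤ ∑ i, (X * ridgeInv ε X) i k ^ 2 := by positivity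
  nlinarith

theorem mul_ridgeInv_apply_self_le_one {ε : ℝ} (hε : 0 < ε) (X : Matrix (Fin n) (Fin p) ℝ)
    (k : Fin p) : ε * ridgeInv ε X k k ≤ 1 := by
  have h := mul_sq_ridgeInv_apply_le hε X k k
  by_contra! hlt
  have h0 : 0 < ridgeInv ε X k k := by
    by_contra! h'
    nlinarith
  nlinarith

theorem abs_mul_ridgeInv_apply_le_one {ε : ℝ} (hε : 0 < ε) (X : Matrix (Fin n) (Fin p) ℝ)
    (j k : Fin p) : |ε * ridgeInv ε X j k| ≤ 1 := by
  rw [← sq_le_one_iff_abs_le_one]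
  have h := mul_sq_ridgeInv_apply_le hε X j k
  have h' := mul_ridgeInv_apply_self_le_one hε X k
  nlinarith

/-- The smoothed projection `K = X G Xᵀ` satisfies `K = ε (X G)(X G)ᵀ + K²`, so each diagonal entry
dominates its own square. -/
theorem mul_ridgeInv_mul_transpose_apply_self_mem {ε : ℝ} (hε : 0 < ε)
    (X : Matrix (Fin n) (Fin p) ℝ) (i : Fin n) :
    (X * ridgeInv ε X * Xᵀ) i i ∈ Set.Icc (0 : ℝ) 1 := by
  set K := X * ridgeInv ε X * Xᵀ with hK
  have hKt : Kᵀ = K := by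
    simp [hK, Matrix.transpose_mul, transpose_ridgeInv, Matrix.mul_assoc]
  have e : K = ε • ((X * ridgeInv ε X) * (X * ridgeInv ε X)ᵀ) + Kᵀ * K := by
    have : K * K = X * ridgeInv ε X * (Xᵀ * X * ridgeInv ε X) * Xᵀ := by
      simp only [hK, Matrix.mul_assoc]
    rw [hKt, this, gram_mul_ridgeInv hε, Matrix.transpose_mul, transpose_ridgeInv]
    simp only [Matrix.mul_sub, Matrix.sub_mul, Matrix.mul_one, Matrix.mul_smul, Matrix.smul_mul,
      Matrix.mul_assoc, hK]
    abel
  have e1 : K i i = ε * ((X * ridgeInv ε X) * (X * ridgeInv ε X)ᵀ) i i + (Kᵀ * K) i i := by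
    conv_lhs => rw [e]
    simp
  have h1 := sq_apply_le_transpose_mul_self K i i
  have h2 : 0 ≤ ((X * ridgeInv ε X) * (X * ridgeInv ε X)ᵀ) i i := by
    simpa using transpose_mul_self_apply_self_nonneg (X * ridgeInv ε X)ᵀ i
  have h3 : 0 ≤ ε * ((X * ridgeInv ε X) * (X * ridgeInv ε X)ᵀ) i i := by positivity
  constructor <;> nlinarith

/-! ### Derivative of `X ↦ X (Xᵀ X + ε I)⁻¹` -/

theorem continuousAt_matrix_inv_of_isUnit {A : Matrix (Fin p) (Fin p) ℝ} (hA : IsUnit A.det) :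
    ContinuousAt Inv.inv A :=
  continuousAt_matrix_inv A (by
    rw [Ring.inverse_eq_inv']; exact continuousAt_inv₀ hA.ne_zero)

theorem continuous_ridgeInv {ε : ℝ} (hε : 0 < ε) :
    Continuous (ridgeInv ε : Matrix (Fin n) (Fin p) ℝ → _) := by
  refine continuous_iff_continuousAt.2 fun X => ?_
  exact ContinuousAt.comp (g := Inv.inv)
    (f := fun X : Matrix (Fin n) (Fin p) ℝ => Xᵀ * X + ε • (1 : Matrix (Fin p) (Fin p) ℝ))
    (continuousAt_matrix_inv_of_isUnit (isUnit_det_gram_add_smul_one hε X)) (by fun_prop)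

/-- The derivative of the entry `(i, k)` of `X (Xᵀ X + ε I)⁻¹` with respect to `X i j`. -/
noncomputable def ridgeDeriv (ε : ℝ) (i : Fin n) (j k : Fin p) (X : Matrix (Fin n) (Fin p) ℝ) : ℝ :=
  ridgeInv ε X j k - (X * ridgeInv ε X) i j * (X * ridgeInv ε X) i k -
    (X * ridgeInv ε X * Xᵀ) i i * ridgeInv ε X j k

/-- Resolvent identity. It gives an exact difference quotient, so no derivative of matrix inversion
is needed. -/
theorem ridgeInv_sub_ridgeInv {ε : ℝ} (hε : 0 < ε) (X Y : Matrix (Fin n) (Fin p) ℝ) :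
    ridgeInv ε Y = ridgeInv ε X - ridgeInv ε Y * (Yᵀ * Y - Xᵀ * X) * ridgeInv ε X := by
  have h1 : ridgeInv ε Y * (Yᵀ * Y) = 1 - ε • ridgeInv ε Y := by
    have := congrArg Matrix.transpose (gram_mul_ridgeInv hε Y)
    simpa [Matrix.transpose_mul, transpose_ridgeInv] using this
  rw [Matrix.mul_sub, Matrix.sub_mul, h1, Matrix.mul_assoc, gram_mul_ridgeInv hε X]
  simp only [Matrix.mul_sub, Matrix.sub_mul, Matrix.mul_one, Matrix.mul_smul, Matrix.smul_mul,
    Matrix.one_mul]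
  abel

theorem hasDerivAt_zero_of_eq_add_mul {f r : ℝ → ℝ} (hr : ContinuousAt r 0)
    (h : ∀ t, f t = f 0 + t * r t) : HasDerivAt f (r 0) 0 := by
  rw [hasDerivAt_iff_tendsto_slope]
  refine (hr.tendsto.mono_left nhdsWithin_le_nhds).congr' ?_
  filter_upwards [self_mem_nhdsWithin] with t ht
  have ht' : t ≠ 0 := ht
  rw [slope_def_field, h t]
  field_simp
  ring

theorem mul_single_one_mul_apply {l m : ℕ} (A : Matrix (Fin l) (Fin n) ℝ)
    (B : Matrix (Fin p) (Fin m) ℝ) (i : Fin n) (j : Fin p) (a : Fin l) (b : Fin m) :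
    (A * Matrix.single i j (1 : ℝ) * B) a b = A a i * B j b := by
  rw [Matrix.mul_apply, Finset.sum_eq_single j]
  · simp
  · intro k _ hk
    simp [Matrix.mul_single_apply_of_ne (hbj := hk)]
  · simp

theorem hasDerivAt_mul_ridgeInv {ε : ℝ} (hε : 0 < ε) (i : Fin n) (j k : Fin p)
    (X : Matrix (Fin n) (Fin p) ℝ) :
    HasDerivAt (fun t : ℝ => ((X + t • Matrix.single i j (1 : ℝ)) *
      ridgeInv ε (X + t • Matrix.single i j (1 : ℝ))) i k) (ridgeDeriv ε i j k X) 0 := by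
  set E : Matrix (Fin n) (Fin p) ℝ := Matrix.single i j (1 : ℝ) with hE
  set G : ℝ → Matrix (Fin p) (Fin p) ℝ := fun t => ridgeInv ε (X + t • E) with hG
  -- The exact difference quotient of the entry for `t ≠ 0`; being continuous, its value at `0` is
  -- the derivative.
  let r : ℝ → ℝ := fun t =>
    (E * G t - X * (G t * (Eᵀ * X + Xᵀ * E + t • (Eᵀ * E)) * ridgeInv ε X)) i k
  have hGc : Continuous G := (continuous_ridgeInv hε).comp (by fun_prop)
  have hG0 : G 0 = ridgeInv ε X := by simp [hG]
  have hr : Continuous r := by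
    have : Continuous (fun t => E * G t -
        X * (G t * (Eᵀ * X + Xᵀ * E + t • (Eᵀ * E)) * ridgeInv ε X)) := by fun_prop
    exact this.matrix_elem i k
  have hr0 : r 0 = ridgeDeriv ε i j k X := by
    have e1 : (E * ridgeInv ε X) i k = ridgeInv ε X j k := by simp [hE]
    have e2 : X * (ridgeInv ε X * (Eᵀ * X + Xᵀ * E) * ridgeInv ε X) =
        (X * ridgeInv ε X) * Eᵀ * (X * ridgeInv ε X) +
        (X * ridgeInv ε X * Xᵀ) * E * ridgeInv ε X := by
      simp only [Matrix.mul_add, Matrix.add_mul, Matrix.mul_assoc]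
    simp only [r, hG0, zero_smul, add_zero]
    rw [Matrix.sub_apply, e1, e2, Matrix.add_apply, hE, Matrix.transpose_single,
      mul_single_one_mul_apply, mul_single_one_mul_apply, ridgeDeriv]
    ring
  rw [← hr0]
  refine hasDerivAt_zero_of_eq_add_mul hr.continuousAt fun t => ?_
  have hd : (X + t • E)ᵀ * (X + t • E) - Xᵀ * X = t • (Eᵀ * X + Xᵀ * E + t • (Eᵀ * E)) := by
    simp only [Matrix.transpose_add, Matrix.transpose_smul, Matrix.mul_add, Matrix.add_mul,
      Matrix.mul_smul, Matrix.smul_mul, smul_add]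
    abel
  have hGt : G t = ridgeInv ε X -
      t • (G t * (Eᵀ * X + Xᵀ * E + t • (Eᵀ * E)) * ridgeInv ε X) := by
    have h := ridgeInv_sub_ridgeInv hε X (X + t • E)
    rw [hd, Matrix.mul_smul, Matrix.smul_mul] at h
    exact h
  have hXG : (X + t • E) * G t = X * ridgeInv ε X +
      t • (E * G t - X * (G t * (Eᵀ * X + Xᵀ * E + t • (Eᵀ * E)) * ridgeInv ε X)) := by
    rw [Matrix.add_mul]
    conv_lhs => enter [1]; rw [hGt]
    rw [Matrix.mul_sub, Matrix.mul_smul, Matrix.smul_mul, smul_sub]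
    abel
  change ((X + t • E) * G t) i k = ((X + (0 : ℝ) • E) * G 0) i k + t * r t
  rw [hXG, hG0, zero_smul, add_zero]
  simp [r]

theorem continuous_mul_ridgeInv_apply {ε : ℝ} (hε : 0 < ε) (i : Fin n) (k : Fin p) :
    Continuous (fun X : Matrix (Fin n) (Fin p) ℝ => (X * ridgeInv ε X) i k) :=
  (continuous_id.matrix_mul (continuous_ridgeInv hε)).matrix_elem i k

theorem continuous_ridgeDeriv {ε : ℝ} (hε : 0 < ε) (i : Fin n) (j k : Fin p) :
    Continuous (ridgeDeriv ε i j k) := by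
  have h := continuous_ridgeInv (n := n) (p := p) hε
  have h1 := continuous_mul_ridgeInv_apply (n := n) (p := p) hε
  have h2 : Continuous (fun X : Matrix (Fin n) (Fin p) ℝ => (X * ridgeInv ε X * Xᵀ) i i) :=
    ((continuous_id.matrix_mul h).matrix_mul continuous_id.matrix_transpose).matrix_elem i i
  exact ((h.matrix_elem j k).sub ((h1 i j).mul (h1 i k))).sub (h2.mul (h.matrix_elem j k))

/-- The constant is chosen to serve also for `ridgeDeriv`, whose three terms are each at most `1 /
ε`, because Stein's identity takes one bound for the function and its derivative. -/
theorem abs_mul_ridgeInv_apply_le {ε : ℝ} (hε : 0 < ε) (i : Fin n) (k : Fin p)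
    (X : Matrix (Fin n) (Fin p) ℝ) : |(X * ridgeInv ε X) i k| ≤ 3 / ε + 1 := by
  have h1 := sq_mul_ridgeInv_apply_le hε X i k
  have h2 : ridgeInv ε X k k ≤ 1 / ε := by
    rw [le_div_iff₀ hε, mul_comm]; exact mul_ridgeInv_apply_self_le_one hε X k
  have h3 : 3 / ε = 3 * (1 / ε) := by ring
  have h4 : 0 < 1 / ε := by positivity
  rw [abs_le]
  constructor <;> nlinarith [sq_nonneg ((X * ridgeInv ε X) i k + 1),
    sq_nonneg ((X * ridgeInv ε X) i k - 1)]

theorem abs_ridgeDeriv_le {ε : ℝ} (hε : 0 < ε) (i : Fin n) (j k : Fin p)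
    (X : Matrix (Fin n) (Fin p) ℝ) : |ridgeDeriv ε i j k X| ≤ 3 / ε + 1 := by
  have h0 : ∀ l, ridgeInv ε X l l ≤ 1 / ε := fun l => by
    rw [le_div_iff₀ hε, mul_comm]; exact mul_ridgeInv_apply_self_le_one hε X l
  have h1 : |ridgeInv ε X j k| ≤ 1 / ε := by
    have := abs_mul_ridgeInv_apply_le_one hε X j k
    rw [abs_mul, abs_of_pos hε] at this
    rw [le_div_iff₀ hε, mul_comm]; exact this
  have h2 : |(X * ridgeInv ε X) i j * (X * ridgeInv ε X) i k| ≤ 1 / ε := by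
    have a := (sq_mul_ridgeInv_apply_le hε X i j).trans (h0 j)
    have b := (sq_mul_ridgeInv_apply_le hε X i k).trans (h0 k)
    rw [abs_le]
    constructor <;> nlinarith [sq_nonneg ((X * ridgeInv ε X) i j + (X * ridgeInv ε X) i k),
      sq_nonneg ((X * ridgeInv ε X) i j - (X * ridgeInv ε X) i k)]
  obtain ⟨k0, k1⟩ := mul_ridgeInv_mul_transpose_apply_self_mem hε X i
  have h3 : |(X * ridgeInv ε X * Xᵀ) i i * ridgeInv ε X j k| ≤ 1 / ε := by
    rw [abs_mul, abs_of_nonneg k0]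
    exact (mul_le_of_le_one_left (abs_nonneg _) k1).trans h1
  have h4 : 3 / ε = 1 / ε + 1 / ε + 1 / ε := by ring
  rw [ridgeDeriv, h4]
  have := abs_sub (ridgeInv ε X j k - (X * ridgeInv ε X) i j * (X * ridgeInv ε X) i k)
    ((X * ridgeInv ε X * Xᵀ) i i * ridgeInv ε X j k)
  have := abs_sub (ridgeInv ε X j k) ((X * ridgeInv ε X) i j * (X * ridgeInv ε X) i k)
  linarith

theorem trace_mul_ridgeInv_nonneg {ε : ℝ} (hε : 0 < ε) {Q : Matrix (Fin p) (Fin p) ℝ}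
    (hQ : Q.PosSemidef) (X : Matrix (Fin n) (Fin p) ℝ) : 0 ≤ (Q * ridgeInv ε X).trace := by
  have h1 := trace_mul_transpose_mul_self_nonneg hQ (X * ridgeInv ε X)
  have h2 := trace_mul_transpose_mul_self_nonneg hQ (ridgeInv ε X)
  rw [ridgeInv_mul_gram_mul hε, Matrix.mul_sub, Matrix.trace_sub, Matrix.mul_smul,
    Matrix.trace_smul, smul_eq_mul] at h1
  rw [transpose_ridgeInv] at h2
  have := mul_nonneg hε.le h2
  linarith

/-- The divergence of `X ↦ X (Xᵀ X + ε I)⁻¹ Q` dominates `(n - p - 1) tr (Q (Xᵀ X + ε I)⁻¹)`. -/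
theorem trace_mul_ridgeInv_le_divergence {ε : ℝ} (hε : 0 < ε) {Q : Matrix (Fin p) (Fin p) ℝ}
    (hQ : Q.PosSemidef) (X : Matrix (Fin n) (Fin p) ℝ) :
    ((n : ℝ) - p - 1) * (Q * ridgeInv ε X).trace ≤
      ∑ i, ∑ j, ∑ k, Q j k * ridgeDeriv ε i j k X := by
  set G := ridgeInv ε X with hG
  have hGt : Gᵀ = G := transpose_ridgeInv ε X
  have hsym : ∀ a b, G a b = G b a := fun a b => congrFun (congrFun hGt b) a
  have hGG := ridgeInv_mul_gram_mul hε X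
  rw [← hG] at hGG
  have htr : (X * G * Xᵀ).trace = p - ε * G.trace := by
    rw [Matrix.trace_mul_comm, ← Matrix.mul_assoc, gram_mul_ridgeInv hε]
    simp [hG]
  -- Summing over rows, the three terms give `n G`, `-(G - ε G²)` and `-(p - ε tr G) G`. The
  -- remainders `ε (tr G) G` and `ε G²` have nonnegative trace against `Q` and are dropped.
  have hsum : ∀ j k, ∑ i, ridgeDeriv ε i j k X =
      ((n : ℝ) - p - 1) * G j k + ε * G.trace * G j k + ε * (G * G) j k := by
    intro j k
    have e1 : ∑ i, (X * G) i j * (X * G) i k = G j k - ε * (G * G) j k := by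
      have := congrFun (congrFun hGG j) k
      rw [Matrix.mul_apply] at this
      simpa using this
    have e2 : ∑ i, (X * G * Xᵀ) i i = p - ε * G.trace := htr
    simp only [ridgeDeriv, Finset.sum_sub_distrib, ← Finset.sum_mul, ← hG, e1, e2]
    simp
    ring
  have hrw : ∑ i, ∑ j, ∑ k, Q j k * ridgeDeriv ε i j k X =
      ((n : ℝ) - p - 1) * (Q * G).trace + ε * G.trace * (Q * G).trace
        + ε * (Q * (G * G)).trace := by
    have t : ∀ A : Matrix (Fin p) (Fin p) ℝ, Aᵀ = A →
        (Q * A).trace = ∑ j, ∑ k, Q j k * A j k := by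
      intro A hA
      simp only [Matrix.trace, Matrix.diag, Matrix.mul_apply]
      exact Finset.sum_congr rfl fun j _ => Finset.sum_congr rfl fun k _ => by
        rw [← congrFun (congrFun hA j) k, Matrix.transpose_apply]
    rw [Finset.sum_comm, t G hGt, t (G * G) (by rw [Matrix.transpose_mul, hGt])]
    simp only [Finset.mul_sum, ← Finset.sum_add_distrib]
    refine Finset.sum_congr rfl fun j _ => ?_
    rw [Finset.sum_comm]
    refine Finset.sum_congr rfl fun k _ => ?_
    rw [← Finset.mul_sum, hsum]
    ring
  have hQGG : 0 ≤ (Q * (G * G)).trace := by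
    have := trace_mul_transpose_mul_self_nonneg hQ G
    rwa [hGt] at this
  have hQG : 0 ≤ (Q * G).trace := trace_mul_ridgeInv_nonneg hε hQ X
  have htG : 0 ≤ G.trace := Finset.sum_nonneg fun k _ => ridgeInv_apply_self_nonneg hε X k
  rw [hrw]
  have : 0 ≤ ε * G.trace * (Q * G).trace := by positivity
  have : 0 ≤ ε * (Q * (G * G)).trace := by positivity
  linarith

/-! ### The inverse Gram matrix -/

theorem transpose_inv_gram (X : Matrix (Fin n) (Fin p) ℝ) : ((Xᵀ * X)⁻¹)ᵀ = (Xᵀ * X)⁻¹ := by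
  rw [Matrix.transpose_nonsing_inv]
  simp

/-- True also for singular `Xᵀ X`, whose inverse is `0` by convention; bounds deduced from it hold
at every outcome. -/
theorem inv_gram_eq (X : Matrix (Fin n) (Fin p) ℝ) :
    (X * (Xᵀ * X)⁻¹)ᵀ * (X * (Xᵀ * X)⁻¹) = (Xᵀ * X)⁻¹ := by
  by_cases h : IsUnit (Xᵀ * X).det
  · rw [Matrix.transpose_mul, transpose_inv_gram, Matrix.mul_assoc, ← Matrix.mul_assoc Xᵀ,
      Matrix.mul_nonsing_inv _ h, Matrix.mul_one]
  · rw [Matrix.nonsing_inv_apply_not_isUnit _ h]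
    simp

/-- Iterating `H - G = ε H G` for `H = (Xᵀ X)⁻¹` exhibits the difference as a sum of Gram matrices.
Hence the diagonal of `G` lies below that of `H`, which supplies the dominating functions as `ε →
0`. -/
theorem inv_gram_sub_ridgeInv {ε : ℝ} (hε : 0 < ε) {X : Matrix (Fin n) (Fin p) ℝ}
    (hX : IsUnit (Xᵀ * X).det) :
    (Xᵀ * X)⁻¹ - ridgeInv ε X = ε • ((ridgeInv ε X)ᵀ * ridgeInv ε X) +
      ε ^ 2 • ((X * (Xᵀ * X)⁻¹ * ridgeInv ε X)ᵀ * (X * (Xᵀ * X)⁻¹ * ridgeInv ε X)) := by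
  have hinv := inv_gram_eq X
  set H := (Xᵀ * X)⁻¹ with hH
  set G := ridgeInv ε X with hG
  have hGt : Gᵀ = G := transpose_ridgeInv ε X
  have h1 : H - G = ε • (H * G) := by
    have h := congrArg (fun A => H * A) (gram_mul_ridgeInv hε X)
    simp only [← Matrix.mul_assoc] at h
    rw [Matrix.mul_assoc H, Matrix.nonsing_inv_mul _ hX, Matrix.one_mul, ← hG, Matrix.mul_sub,
      Matrix.mul_one, Matrix.mul_smul] at h
    exact (sub_eq_iff_eq_add'.2 (eq_sub_iff_add_eq.1 h).symm)
  have h2 : H - G = ε • (G * H) := by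
    have := congrArg Matrix.transpose h1
    simpa [Matrix.transpose_mul, hGt, transpose_inv_gram, hH] using this
  have h3 : (X * H * G)ᵀ * (X * H * G) = G * H * G := by
    rw [Matrix.transpose_mul, hGt, Matrix.mul_assoc, ← Matrix.mul_assoc (X * H)ᵀ, hinv,
      Matrix.mul_assoc]
  have h4 : H * G = G * G + ε • (G * H * G) := by
    rw [← Matrix.smul_mul, ← h2, Matrix.sub_mul]; abel
  rw [h3, hGt]
  conv_lhs => rw [h1, h4]
  rw [smul_add, smul_smul, sq]

theorem ridgeInv_apply_self_le {ε : ℝ} (hε : 0 < ε) {X : Matrix (Fin n) (Fin p) ℝ}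
    (hX : IsUnit (Xᵀ * X).det) (k : Fin p) : ridgeInv ε X k k ≤ (Xᵀ * X)⁻¹ k k := by
  have h := congrFun (congrFun (inv_gram_sub_ridgeInv hε hX) k) k
  have h1 := transpose_mul_self_apply_self_nonneg (ridgeInv ε X) k
  have h2 := transpose_mul_self_apply_self_nonneg (X * (Xᵀ * X)⁻¹ * ridgeInv ε X) k
  rw [Matrix.sub_apply, Matrix.add_apply, Matrix.smul_apply, Matrix.smul_apply, smul_eq_mul,
    smul_eq_mul] at h
  have := mul_nonneg hε.le h1
  have := mul_nonneg (sq_nonneg ε) h2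
  linarith

theorem inv_gram_apply_self_nonneg (X : Matrix (Fin n) (Fin p) ℝ) (k : Fin p) :
    0 ≤ (Xᵀ * X)⁻¹ k k := by
  rw [← inv_gram_eq]
  exact transpose_mul_self_apply_self_nonneg _ k

theorem abs_inv_gram_apply_le (X : Matrix (Fin n) (Fin p) ℝ) (j k : Fin p) :
    |(Xᵀ * X)⁻¹ j k| ≤ (Xᵀ * X)⁻¹ j j + (Xᵀ * X)⁻¹ k k := by
  have h := abs_transpose_mul_self_le (X * (Xᵀ * X)⁻¹) j k
  rwa [inv_gram_eq] at h

theorem abs_ridgeInv_apply_le {ε : ℝ} (hε : 0 < ε) {X : Matrix (Fin n) (Fin p) ℝ} (j k : Fin p) :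
    |ridgeInv ε X j k| ≤ ridgeInv ε X j j + ridgeInv ε X k k := by
  set G := ridgeInv ε X with hG
  have h := ridgeInv_mul_gram_mul hε X
  have hGt : Gᵀ = G := transpose_ridgeInv ε X
  have e : G = (X * G)ᵀ * (X * G) + ε • (Gᵀ * G) := by rw [h, hGt]; abel
  have e' : ∀ a b, G a b = ((X * G)ᵀ * (X * G)) a b + ε * (Gᵀ * G) a b := fun a b => by
    conv_lhs => rw [e]
    simp
  have h1 := abs_transpose_mul_self_le (X * G) j k
  have h2 := mul_le_mul_of_nonneg_left (abs_transpose_mul_self_le G j k) hε.le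
  rw [e' j k, e' j j, e' k k]
  refine (abs_add_le _ _).trans ?_
  rw [abs_mul, abs_of_pos hε]
  linarith

/-- Operator convexity of the matrix inverse, in the form of its tangent inequality. -/
theorem trace_mul_inv_gram_ge {Q : Matrix (Fin p) (Fin p) ℝ} (hQ : Q.PosSemidef)
    {X : Matrix (Fin n) (Fin p) ℝ} (hX : IsUnit (Xᵀ * X).det) {B : Matrix (Fin p) (Fin p) ℝ}
    (hB : Bᵀ = B) :
    2 * (Q * B).trace - (Q * (B * (Xᵀ * X) * B)).trace ≤ (Q * (Xᵀ * X)⁻¹).trace := by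
  have h := trace_mul_transpose_mul_self_nonneg hQ (X * (Xᵀ * X)⁻¹ - X * B)
  -- Completing the square: the gap in the inequality is the trace of `Q` against this Gram matrix.
  have e : (X * (Xᵀ * X)⁻¹ - X * B)ᵀ * (X * (Xᵀ * X)⁻¹ - X * B) =
      (Xᵀ * X)⁻¹ - B - B + B * (Xᵀ * X) * B := by
    rw [Matrix.transpose_sub, Matrix.sub_mul, Matrix.mul_sub, Matrix.mul_sub, inv_gram_eq]
    have e1 : (X * (Xᵀ * X)⁻¹)ᵀ * (X * B) = B := by
      rw [Matrix.transpose_mul, transpose_inv_gram, Matrix.mul_assoc, ← Matrix.mul_assoc Xᵀ,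
        ← Matrix.mul_assoc, Matrix.nonsing_inv_mul _ hX, Matrix.one_mul]
    have e2 : (X * B)ᵀ * (X * (Xᵀ * X)⁻¹) = B := by
      rw [Matrix.transpose_mul, hB, Matrix.mul_assoc, ← Matrix.mul_assoc Xᵀ,
        Matrix.mul_nonsing_inv _ hX, Matrix.mul_one]
    have e3 : (X * B)ᵀ * (X * B) = B * (Xᵀ * X) * B := by
      rw [Matrix.transpose_mul, hB]; simp only [Matrix.mul_assoc]
    rw [e1, e2, e3]; abel
  rw [e, Matrix.mul_add, Matrix.mul_sub, Matrix.mul_sub, Matrix.trace_add, Matrix.trace_sub,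
    Matrix.trace_sub] at h
  linarith

/-- A kernel vector satisfies `v = ε G v`. Cauchy–Schwarz with `ε ‖G e_j‖² ≤ G j j` gives `v j ^ 2 ≤
ε G j j ‖v‖²`; sum over `j` and cancel `‖v‖²`. -/
theorem one_le_mul_trace_ridgeInv_of_det_eq_zero {ε : ℝ} (hε : 0 < ε)
    {X : Matrix (Fin n) (Fin p) ℝ} (hX : (Xᵀ * X).det = 0) : 1 ≤ ε * (ridgeInv ε X).trace := by
  obtain ⟨v, hv0, hv⟩ := Matrix.exists_mulVec_eq_zero_iff.mpr hX
  have hGt : (ridgeInv ε X)ᵀ = ridgeInv ε X := transpose_ridgeInv ε X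
  have hGS : ridgeInv ε X * (Xᵀ * X) = 1 - ε • ridgeInv ε X := by
    have := congrArg Matrix.transpose (gram_mul_ridgeInv hε X)
    simpa [Matrix.transpose_mul, hGt] using this
  have hGv : ∀ j, v j = ε * ∑ k, ridgeInv ε X k j * v k := by
    have h : (ridgeInv ε X * (Xᵀ * X)) *ᵥ v = 0 := by
      rw [← Matrix.mulVec_mulVec, hv, Matrix.mulVec_zero]
    rw [hGS, Matrix.sub_mulVec, Matrix.one_mulVec, Matrix.smul_mulVec, sub_eq_zero] at h
    intro j
    conv_lhs => rw [h]
    simp only [Pi.smul_apply, smul_eq_mul, Matrix.mulVec, dotProduct]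
    congr 1
    exact Finset.sum_congr rfl fun k _ => by rw [← congrFun (congrFun hGt j) k]; rfl
  have hle : ∀ j, v j ^ 2 ≤ ε * ridgeInv ε X j j * ∑ k, v k ^ 2 := by
    intro j
    have cs := Finset.sum_mul_sq_le_sq_mul_sq Finset.univ (fun k => ridgeInv ε X k j) v
    have hd : ε * ∑ k, ridgeInv ε X k j ^ 2 ≤ ridgeInv ε X j j := by
      rw [ridgeInv_apply_self hε X j]
      have : 0 ≤ ∑ i, (X * ridgeInv ε X) i j ^ 2 := by positivity
      linarith
    have hs : 0 ≤ ∑ k, v k ^ 2 := by positivity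
    calc v j ^ 2 = ε ^ 2 * (∑ k, ridgeInv ε X k j * v k) ^ 2 := by rw [hGv j]; ring
      _ ≤ ε ^ 2 * ((∑ k, ridgeInv ε X k j ^ 2) * ∑ k, v k ^ 2) := by gcongr
      _ = ε * (ε * ∑ k, ridgeInv ε X k j ^ 2) * ∑ k, v k ^ 2 := by ring
      _ ≤ _ := by gcongr
  have hpos : 0 < ∑ k, v k ^ 2 := by
    obtain ⟨j, hj⟩ := Function.ne_iff.1 hv0
    exact Finset.sum_pos' (fun k _ => sq_nonneg _) ⟨j, Finset.mem_univ _, sq_pos_of_ne_zero hj⟩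
  have hsum := Finset.sum_le_sum fun j (_ : j ∈ Finset.univ) => hle j
  rw [← Finset.sum_mul, ← Finset.mul_sum] at hsum
  exact le_of_mul_le_mul_right (by simpa [Matrix.trace] using hsum) hpos

theorem tendsto_ridgeInv_apply {X : Matrix (Fin n) (Fin p) ℝ} (hX : IsUnit (Xᵀ * X).det)
    {u : ℕ → ℝ} (hu : Tendsto u atTop (𝓝 0)) :
    Tendsto (fun m => ridgeInv (u m) X) atTop (𝓝 (Xᵀ * X)⁻¹) := by
  have h1 : Tendsto (fun m => Xᵀ * X + u m • (1 : Matrix (Fin p) (Fin p) ℝ)) atTop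
      (𝓝 (Xᵀ * X)) := by
    simpa using (tendsto_const_nhds (x := Xᵀ * X)).add
      (hu.smul_const (1 : Matrix (Fin p) (Fin p) ℝ))
  exact (continuousAt_matrix_inv_of_isUnit hX).tendsto.comp h1

end RidgeInverse

theorem abs_mul_le_sq_add_sq (a b : ℝ) : |a * b| ≤ a ^ 2 + b ^ 2 := by
  rw [abs_le]
  constructor <;> nlinarith [sq_nonneg (a + b), sq_nonneg (a - b)]

theorem aemeasurable_liminf_atTop {α : Type*} [MeasurableSpace α] {μ : Measure α}
    {f : ℕ → α → ENNReal} (hf : ∀ m, AEMeasurable (f m) μ) :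
    AEMeasurable (fun x => liminf (fun m => f m x) atTop) μ := by
  refine ⟨fun x => liminf (fun m => (hf m).mk (f m) x) atTop,
    .liminf fun m => (hf m).measurable_mk, ?_⟩
  filter_upwards [ae_all_iff.2 fun m => (hf m).ae_eq_mk] with x hx
  simp only [hx]

/-! ### Expectations of traces and of weighted sums. -/

section

variable {Ω : Type*} [MeasurableSpace Ω] {P : Measure Ω} {n p : ℕ}

theorem integrable_trace_mul {A : Ω → Matrix (Fin p) (Fin p) ℝ}
    (hA : ∀ j k, Integrable (fun ω => A ω j k) P) (Q : Matrix (Fin p) (Fin p) ℝ) :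
    Integrable (fun ω => (Q * A ω).trace) P := by
  simp only [Matrix.trace, Matrix.diag, Matrix.mul_apply]
  exact integrable_finsetSum _ fun j _ => integrable_finsetSum _ fun k _ =>
    (hA k j).const_mul _

theorem integral_trace_mul {A : Ω → Matrix (Fin p) (Fin p) ℝ}
    (hA : ∀ j k, Integrable (fun ω => A ω j k) P) (Q : Matrix (Fin p) (Fin p) ℝ) :
    ∫ ω, (Q * A ω).trace ∂P = (Q * Matrix.of fun j k => ∫ ω, A ω j k ∂P).trace := by
  have hI := fun j k => (hA k j).const_mul (Q j k)
  simp only [Matrix.trace, Matrix.diag, Matrix.mul_apply, Matrix.of_apply]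
  rw [integral_finsetSum _ fun j _ => integrable_finsetSum _ fun k _ => hI j k]
  refine Finset.sum_congr rfl fun j _ => ?_
  rw [integral_finsetSum _ fun k _ => hI j k]
  exact Finset.sum_congr rfl fun k _ => integral_const_mul _ _

theorem integrable_sum_const_mul {f : Fin n → Fin p → Fin p → Ω → ℝ}
    (hf : ∀ i j k, Integrable (f i j k) P) (Q : Matrix (Fin p) (Fin p) ℝ) :
    Integrable (fun ω => ∑ i, ∑ j, ∑ k, Q j k * f i j k ω) P :=
  integrable_finsetSum _ fun i _ => integrable_finsetSum _ fun j _ =>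
    integrable_finsetSum _ fun k _ => (hf i j k).const_mul (Q j k)

theorem integral_sum_const_mul {f : Fin n → Fin p → Fin p → Ω → ℝ}
    (hf : ∀ i j k, Integrable (f i j k) P) (Q : Matrix (Fin p) (Fin p) ℝ) :
    ∫ ω, ∑ i, ∑ j, ∑ k, Q j k * f i j k ω ∂P =
      ∑ i, ∑ j, ∑ k, Q j k * ∫ ω, f i j k ω ∂P := by
  have hI := fun i j k => (hf i j k).const_mul (Q j k)
  rw [integral_finsetSum _ fun i _ => integrable_finsetSum _ fun j _ =>
      integrable_finsetSum _ fun k _ => hI i j k]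
  refine Finset.sum_congr rfl fun i _ => ?_
  rw [integral_finsetSum _ fun j _ => integrable_finsetSum _ fun k _ => hI i j k]
  refine Finset.sum_congr rfl fun j _ => ?_
  rw [integral_finsetSum _ fun k _ => hI i j k]
  exact Finset.sum_congr rfl fun k _ => integral_const_mul _ _

end

/-! ### Moments, almost sure invertibility, and the limit `ε → 0`. -/

namespace IsGaussianMatrix

variable {Ω : Type*} [MeasurableSpace Ω] {P : Measure Ω} {n p : ℕ}
  {X : Ω → Matrix (Fin n) (Fin p) ℝ} {M : Matrix (Fin n) (Fin p) ℝ}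

theorem memLp_entry (hX : IsGaussianMatrix X M P) (i : Fin n) (j : Fin p) :
    MemLp (fun ω => X ω i j) 2 P := by
  have h := memLp_id_gaussianReal (μ := M i j) (v := 1) 2
  rw [← (hX.hasLaw_entry i j).map_eq, memLp_map_measure_iff (by fun_prop)
    (hX.hasLaw_entry i j).aemeasurable] at h
  exact h

theorem integral_entry (hX : IsGaussianMatrix X M P) (i : Fin n) (j : Fin p) :
    ∫ ω, X ω i j ∂P = M i j := by
  rw [(hX.hasLaw_entry i j).integral_eq, integral_id_gaussianReal]

theorem integrable_entry_mul (hX : IsGaussianMatrix X M P) (i : Fin n) (j k : Fin p) :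
    Integrable (fun ω => X ω i j * X ω i k) P :=
  (hX.memLp_entry i j).integrable_mul (hX.memLp_entry i k)

theorem integrable_gram (hX : IsGaussianMatrix X M P) (j k : Fin p) :
    Integrable (fun ω => ((X ω)ᵀ * X ω) j k) P := by
  simp only [Matrix.mul_apply, Matrix.transpose_apply]
  exact integrable_finsetSum _ fun i _ => hX.integrable_entry_mul i j k

variable [IsProbabilityMeasure P]

theorem aemeasurable_comp (hX : IsGaussianMatrix X M P) {f : Matrix (Fin n) (Fin p) ℝ → ℝ}
    (hf : Continuous f) : AEMeasurable (fun ω => f (X ω)) P := by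
  have he : Continuous (fun x : Fin n × Fin p → ℝ => Matrix.of fun i j => x (i, j)) :=
    continuous_matrix fun i j => continuous_apply _
  exact (hf.comp he).measurable.comp_aemeasurable hX.hasLaw_pi.aemeasurable

theorem memLp_entry_sub (hX : IsGaussianMatrix X M P) (i : Fin n) (j : Fin p) :
    MemLp (fun ω => X ω i j - M i j) 2 P :=
  (hX.memLp_entry i j).sub (memLp_const _)

theorem integrable_entry_sub (hX : IsGaussianMatrix X M P) (i : Fin n) (j : Fin p) :
    Integrable (fun ω => X ω i j - M i j) P :=
  (hX.memLp_entry_sub i j).integrable (by norm_num)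

theorem integrable_entry_sub_mul (hX : IsGaussianMatrix X M P) (i k : Fin n) (j l : Fin p) :
    Integrable (fun ω => (X ω i j - M i j) * (X ω k l - M k l)) P :=
  (hX.memLp_entry_sub i j).integrable_mul (hX.memLp_entry_sub k l)

theorem integral_entry_sub (hX : IsGaussianMatrix X M P) (i : Fin n) (j : Fin p) :
    ∫ ω, (X ω i j - M i j) ∂P = 0 := by
  rw [integral_sub ((hX.memLp_entry i j).integrable (by norm_num)) (integrable_const _),
    hX.integral_entry]
  simp

theorem integral_entry_sub_mul (hX : IsGaussianMatrix X M P) (i : Fin n) (j k : Fin p) :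
    ∫ ω, (X ω i j - M i j) * (X ω i k - M i k) ∂P = (1 : Matrix (Fin p) (Fin p) ℝ) j k := by
  rcases eq_or_ne j k with rfl | hjk
  · have h := (hX.hasLaw_entry i j).variance_eq
    rw [variance_id_gaussianReal, variance_eq_integral (hX.hasLaw_entry i j).aemeasurable,
      hX.integral_entry] at h
    simpa [sq] using h
  · have hne : (i, j) ≠ (i, k) := fun h => hjk (Prod.mk.inj h).2
    have hind := (hX.indep_entries.indepFun hne).comp (φ := fun x => x - M i j)
      (ψ := fun x => x - M i k) (by fun_prop) (by fun_prop)
    have := hind.integral_mul_eq_mul_integral (hX.integrable_entry_sub i j).1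
      (hX.integrable_entry_sub i k).1
    rw [Matrix.one_apply_ne hjk]
    refine Eq.trans this ?_
    rw [mul_eq_zero]
    exact Or.inl (hX.integral_entry_sub i j)

theorem integrable_sub_mul_ridgeInv (hX : IsGaussianMatrix X M P) {ε : ℝ} (hε : 0 < ε)
    (i : Fin n) (j k : Fin p) :
    Integrable (fun ω => (X ω i j - M i j) * (X ω * ridgeInv ε (X ω)) i k) P :=
  (hX.integrable_entry_sub i j).mul_bdd
    (hX.aemeasurable_comp (continuous_mul_ridgeInv_apply hε i k)).aestronglyMeasurable
    (ae_of_all _ fun ω => abs_mul_ridgeInv_apply_le hε i k (X ω))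

theorem integrable_ridgeInv (hX : IsGaussianMatrix X M P) {ε : ℝ} (hε : 0 < ε) (j k : Fin p) :
    Integrable (fun ω => ridgeInv ε (X ω) j k) P := by
  refine .of_bound (hX.aemeasurable_comp
    ((continuous_ridgeInv hε).matrix_elem j k)).aestronglyMeasurable (1 / ε)
    (ae_of_all _ fun ω => ?_)
  have := abs_mul_ridgeInv_apply_le_one hε (X ω) j k
  rw [abs_mul, abs_of_pos hε] at this
  rw [Real.norm_eq_abs, le_div_iff₀ hε, mul_comm]
  exact this

theorem integrable_ridgeDeriv (hX : IsGaussianMatrix X M P) {ε : ℝ} (hε : 0 < ε) (i : Fin n)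
    (j k : Fin p) : Integrable (fun ω => ridgeDeriv ε i j k (X ω)) P :=
  .of_bound (hX.aemeasurable_comp (continuous_ridgeDeriv hε i j k)).aestronglyMeasurable _
    (ae_of_all _ fun ω => abs_ridgeDeriv_le hε i j k (X ω))

/-- The integrated divergence bound for the regularized inverse. -/
theorem integral_trace_ridgeInv_le (hX : IsGaussianMatrix X M P) {ε : ℝ} (hε : 0 < ε)
    {Q : Matrix (Fin p) (Fin p) ℝ} (hQ : Q.PosSemidef) :
    ((n : ℝ) - p - 1) * ∫ ω, (Q * ridgeInv ε (X ω)).trace ∂P ≤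
      ∫ ω, ∑ i, ∑ j, ∑ k, Q j k * ((X ω i j - M i j) * (X ω * ridgeInv ε (X ω)) i k) ∂P := by
  have e : ∫ ω, ∑ i, ∑ j, ∑ k, Q j k * ((X ω i j - M i j) * (X ω * ridgeInv ε (X ω)) i k) ∂P =
      ∫ ω, ∑ i, ∑ j, ∑ k, Q j k * ridgeDeriv ε i j k (X ω) ∂P := by
    rw [integral_sum_const_mul (hX.integrable_sub_mul_ridgeInv hε),
      integral_sum_const_mul (hX.integrable_ridgeDeriv hε)]
    refine Finset.sum_congr rfl fun i _ => Finset.sum_congr rfl fun j _ =>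
      Finset.sum_congr rfl fun k _ => ?_
    congr 1
    exact hX.integral_sub_mul i j (f := fun Y => (Y * ridgeInv ε Y) i k)
      (continuous_mul_ridgeInv_apply hε i k) (continuous_ridgeDeriv hε i j k)
      (hasDerivAt_mul_ridgeInv hε i j k) (abs_mul_ridgeInv_apply_le hε i k)
      (abs_ridgeDeriv_le hε i j k)
  rw [e, ← integral_const_mul]
  refine integral_mono ((integrable_trace_mul (hX.integrable_ridgeInv hε) Q).const_mul _)
    (integrable_sum_const_mul (hX.integrable_ridgeDeriv hε) Q) fun ω => ?_
  exact trace_mul_ridgeInv_le_divergence hε hQ (X ω)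

/-- A bound independent of `ε`: with `Q = I`, Young's inequality on the Stein cross term produces `c
/ 2` times `‖X G‖² ≤ tr G`, which is absorbed by the left side. -/
theorem integral_trace_ridgeInv_bound (hX : IsGaussianMatrix X M P) (hnp : p + 1 < n) {ε : ℝ}
    (hε : 0 < ε) :
    ∫ ω, (ridgeInv ε (X ω)).trace ∂P ≤
      (∫ ω, ∑ i, ∑ j, (X ω i j - M i j) ^ 2 ∂P) / ((n : ℝ) - p - 1) ^ 2 := by
  have hc : 0 < (n : ℝ) - p - 1 := by
    have : (p : ℝ) + 1 < n := by exact_mod_cast hnp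
    linarith
  set c := (n : ℝ) - p - 1 with hcdef
  have h := hX.integral_trace_ridgeInv_le hε Matrix.PosSemidef.one
  simp only [Matrix.one_mul] at h
  have hT : Integrable (fun ω => (ridgeInv ε (X ω)).trace) P := by
    simpa using integrable_trace_mul (hX.integrable_ridgeInv hε) 1
  have hZ : Integrable (fun ω => ∑ i, ∑ j, (X ω i j - M i j) ^ 2) P :=
    integrable_finsetSum _ fun i _ => integrable_finsetSum _ fun j _ => by
      simpa [sq] using hX.integrable_entry_sub_mul i i j j
  have hle : ∫ ω, ∑ i, ∑ j, ∑ k, (1 : Matrix (Fin p) (Fin p) ℝ) j k *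
        ((X ω i j - M i j) * (X ω * ridgeInv ε (X ω)) i k) ∂P ≤
      ∫ ω, ((2 * c)⁻¹ * ∑ i, ∑ j, (X ω i j - M i j) ^ 2 +
        c / 2 * (ridgeInv ε (X ω)).trace) ∂P := by
    refine integral_mono (integrable_sum_const_mul (hX.integrable_sub_mul_ridgeInv hε) _)
      ((hZ.const_mul _).add (hT.const_mul _)) fun ω => ?_
    have h1 : ∑ i, ∑ j, (X ω * ridgeInv ε (X ω)) i j ^ 2 ≤ (ridgeInv ε (X ω)).trace := by
      rw [Finset.sum_comm]
      refine Finset.sum_le_sum fun j _ => ?_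
      rw [Matrix.diag_apply, ridgeInv_apply_self hε (X ω) j]
      have : 0 ≤ ε * ∑ l, ridgeInv ε (X ω) l j ^ 2 := by positivity
      linarith
    have h2 : c / 2 * ∑ i, ∑ j, (X ω * ridgeInv ε (X ω)) i j ^ 2 ≤
        c / 2 * (ridgeInv ε (X ω)).trace := by gcongr
    refine le_trans ?_ (add_le_add_right h2 _)
    simp only [Finset.mul_sum, ← Finset.sum_add_distrib]
    refine Finset.sum_le_sum fun i _ => Finset.sum_le_sum fun j _ => ?_
    rw [Finset.sum_eq_single j (fun k _ hk => by rw [Matrix.one_apply_ne hk.symm, zero_mul])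
      (by simp), Matrix.one_apply_eq, one_mul]
    set a := X ω i j - M i j
    set b := (X ω * ridgeInv ε (X ω)) i j
    have : (2 * c)⁻¹ * a ^ 2 + c / 2 * b ^ 2 - a * b = (2 * c)⁻¹ * (a - c * b) ^ 2 := by
      field_simp
      ring
    have : 0 ≤ (2 * c)⁻¹ * (a - c * b) ^ 2 := by positivity
    linarith
  rw [integral_add (hZ.const_mul _) (hT.const_mul _), integral_const_mul, integral_const_mul]
    at hle
  have h3 := h.trans hle
  rw [le_div_iff₀ (by positivity)]
  have h4 : c / 2 * ∫ ω, (ridgeInv ε (X ω)).trace ∂P ≤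
      (2 * c)⁻¹ * ∫ ω, ∑ i, ∑ j, (X ω i j - M i j) ^ 2 ∂P := by linarith
  have h5 := mul_le_mul_of_nonneg_left h4 (by positivity : 0 ≤ 2 * c)
  rw [← mul_assoc, ← mul_assoc, mul_inv_cancel₀ (by positivity), one_mul] at h5
  linarith

theorem aemeasurable_inv_gram (hX : IsGaussianMatrix X M P) (j k : Fin p) :
    AEMeasurable (fun ω => ((X ω)ᵀ * X ω)⁻¹ j k) P := by
  have h1 : AEMeasurable (fun ω => ((X ω)ᵀ * X ω).det) P :=
    hX.aemeasurable_comp (f := fun Y => (Yᵀ * Y).det) (by fun_prop)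
  have h2 : AEMeasurable (fun ω => ((X ω)ᵀ * X ω).adjugate j k) P :=
    hX.aemeasurable_comp (f := fun Y => (Yᵀ * Y).adjugate j k)
      (Continuous.matrix_elem (by fun_prop) j k)
  -- The adjugate formula is valid everywhere, with `0⁻¹ = 0` in the singular case, so measurability
  -- needs no invertibility.
  simp only [Matrix.inv_def, Ring.inverse_eq_inv', Matrix.smul_apply, smul_eq_mul]
  exact h1.inv.mul h2

/-- Fatou's lemma with the uniform bound. Finiteness of the liminf excludes singular Gram matrices,
and on invertible ones the liminf is the trace of the inverse. -/
theorem lintegral_liminf_trace_ridgeInv_lt_top (hX : IsGaussianMatrix X M P) (hnp : p + 1 < n) :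
    ∫⁻ ω, liminf (fun m : ℕ => ENNReal.ofReal (ridgeInv (1 / ((m : ℝ) + 1)) (X ω)).trace)
      atTop ∂P < ⊤ := by
  have hpos : ∀ m : ℕ, 0 < 1 / ((m : ℝ) + 1) := fun m => by positivity
  have hT : ∀ m : ℕ, Integrable (fun ω => (ridgeInv (1 / ((m : ℝ) + 1)) (X ω)).trace) P :=
    fun m => by simpa using integrable_trace_mul (hX.integrable_ridgeInv (hpos m)) 1
  refine (lintegral_liminf_le' fun m => (hT m).aemeasurable.ennreal_ofReal).trans_lt ?_
  refine lt_of_le_of_lt (b := ENNReal.ofReal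
    ((∫ ω, ∑ i, ∑ j, (X ω i j - M i j) ^ 2 ∂P) / ((n : ℝ) - p - 1) ^ 2)) ?_
    ENNReal.ofReal_lt_top
  refine liminf_le_of_le (by isBoundedDefault) fun b hb => ?_
  obtain ⟨m, hm⟩ := hb.exists
  refine hm.trans ?_
  rw [← ofReal_integral_eq_lintegral_ofReal (hT m) (ae_of_all _ fun ω =>
    Finset.sum_nonneg fun k _ => ridgeInv_apply_self_nonneg (hpos m) (X ω) k)]
  exact ENNReal.ofReal_le_ofReal (hX.integral_trace_ridgeInv_bound hnp (hpos m))

/-- A Gaussian matrix with more rows than columns has an invertible Gram matrix. -/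
theorem ae_isUnit_det_gram (hX : IsGaussianMatrix X M P) (hnp : p + 1 < n) :
    ∀ᵐ ω ∂P, IsUnit ((X ω)ᵀ * X ω).det := by
  have hpos : ∀ m : ℕ, 0 < 1 / ((m : ℝ) + 1) := fun m => by positivity
  have hT : ∀ m : ℕ, AEMeasurable
      (fun ω => ENNReal.ofReal (ridgeInv (1 / ((m : ℝ) + 1)) (X ω)).trace) P :=
    fun m => (Integrable.aemeasurable (by
      simpa using integrable_trace_mul (hX.integrable_ridgeInv (hpos m)) 1)).ennreal_ofReal
  have hfin := ae_lt_top' (aemeasurable_liminf_atTop hT)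
    (hX.lintegral_liminf_trace_ridgeInv_lt_top hnp).ne
  filter_upwards [hfin] with ω hω
  by_contra hdet
  rw [isUnit_iff_ne_zero, not_not] at hdet
  -- For a singular Gram matrix and `ε = 1 / (m + 1)` the trace is at least `m + 1`, so the liminf
  -- would be infinite.
  refine hω.ne (Tendsto.liminf_eq ?_)
  refine tendsto_nhds_top_mono ENNReal.tendsto_nat_nhds_top (Eventually.of_forall fun m => ?_)
  change (m : ENNReal) ≤ _
  rw [← ENNReal.ofReal_natCast]
  refine ENNReal.ofReal_le_ofReal ?_
  have := one_le_mul_trace_ridgeInv_of_det_eq_zero (hpos m) hdet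
  rw [one_div_mul_eq_div, le_div_iff₀ (by positivity)] at this
  linarith

theorem integrable_inv_gram_apply_self (hX : IsGaussianMatrix X M P) (hnp : p + 1 < n)
    (k : Fin p) : Integrable (fun ω => ((X ω)ᵀ * X ω)⁻¹ k k) P := by
  refine ⟨(hX.aemeasurable_inv_gram k k).aestronglyMeasurable, ?_⟩
  rw [hasFiniteIntegral_iff_ofReal (ae_of_all _ fun ω => inv_gram_apply_self_nonneg (X ω) k)]
  refine lt_of_le_of_lt (lintegral_mono_ae ?_) (hX.lintegral_liminf_trace_ridgeInv_lt_top hnp)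
  filter_upwards [hX.ae_isUnit_det_gram hnp] with ω hω
  have h1 := tendsto_ridgeInv_apply hω tendsto_one_div_add_atTop_nhds_zero_nat
  have h2 : Tendsto (fun m : ℕ => (ridgeInv (1 / ((m : ℝ) + 1)) (X ω)).trace) atTop
      (𝓝 ((X ω)ᵀ * X ω)⁻¹.trace) :=
    ((continuous_id.matrix_trace).tendsto _).comp h1
  have h3 := ((ENNReal.continuous_ofReal.tendsto _).comp h2).liminf_eq
  refine le_trans ?_ h3.ge
  exact ENNReal.ofReal_le_ofReal (Finset.single_le_sum
    (f := fun k => ((X ω)ᵀ * X ω)⁻¹ k k)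
    (fun k _ => inv_gram_apply_self_nonneg (X ω) k) (Finset.mem_univ k))

theorem integrable_inv_gram (hX : IsGaussianMatrix X M P) (hnp : p + 1 < n) (j k : Fin p) :
    Integrable (fun ω => ((X ω)ᵀ * X ω)⁻¹ j k) P :=
  ((hX.integrable_inv_gram_apply_self hnp j).add
    (hX.integrable_inv_gram_apply_self hnp k)).mono'
    (hX.aemeasurable_inv_gram j k).aestronglyMeasurable
    (ae_of_all _ fun ω => abs_inv_gram_apply_le (X ω) j k)

theorem aemeasurable_mul_inv_gram (hX : IsGaussianMatrix X M P) (i : Fin n) (k : Fin p) :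
    AEMeasurable (fun ω => (X ω * ((X ω)ᵀ * X ω)⁻¹) i k) P := by
  simp only [Matrix.mul_apply (N := (_)⁻¹)]
  exact Finset.aemeasurable_fun_sum _ fun l _ =>
    (hX.hasLaw_entry i l).aemeasurable.mul (hX.aemeasurable_inv_gram l k)

theorem integrable_sub_sq_add_inv_gram (hX : IsGaussianMatrix X M P) (hnp : p + 1 < n)
    (i : Fin n) (j k : Fin p) :
    Integrable (fun ω => (X ω i j - M i j) ^ 2 + ((X ω)ᵀ * X ω)⁻¹ k k) P :=
  Integrable.add (by simpa [sq] using hX.integrable_entry_sub_mul i i j j)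
    (hX.integrable_inv_gram_apply_self hnp k)

theorem integrable_sub_mul_inv_gram (hX : IsGaussianMatrix X M P) (hnp : p + 1 < n)
    (i : Fin n) (j k : Fin p) :
    Integrable (fun ω => (X ω i j - M i j) * (X ω * ((X ω)ᵀ * X ω)⁻¹) i k) P := by
  refine (hX.integrable_sub_sq_add_inv_gram hnp i j k).mono'
    ((hX.integrable_entry_sub i j).aemeasurable.mul
      (hX.aemeasurable_mul_inv_gram i k)).aestronglyMeasurable (ae_of_all _ fun ω => ?_)
  refine (abs_mul_le_sq_add_sq _ _).trans (add_le_add_right ?_ _)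
  have := sq_apply_le_transpose_mul_self (X ω * ((X ω)ᵀ * X ω)⁻¹) i k
  rwa [inv_gram_eq] at this

/-- The integrated divergence bound for `X (Xᵀ X)⁻¹ Q`. -/
theorem integral_trace_inv_gram_le (hX : IsGaussianMatrix X M P) (hnp : p + 1 < n)
    {Q : Matrix (Fin p) (Fin p) ℝ} (hQ : Q.PosSemidef) :
    ((n : ℝ) - p - 1) * ∫ ω, (Q * ((X ω)ᵀ * X ω)⁻¹).trace ∂P ≤
      ∫ ω, ∑ i, ∑ j, ∑ k, Q j k * ((X ω i j - M i j) * (X ω * ((X ω)ᵀ * X ω)⁻¹) i k) ∂P := by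
  have hpos : ∀ m : ℕ, 0 < 1 / ((m : ℝ) + 1) := fun m => by positivity
  have hunit := hX.ae_isUnit_det_gram hnp
  have l1 : ∀ j k, Tendsto (fun m : ℕ => ∫ ω, ridgeInv (1 / ((m : ℝ) + 1)) (X ω) j k ∂P) atTop
      (𝓝 (∫ ω, ((X ω)ᵀ * X ω)⁻¹ j k ∂P)) := by
    intro j k
    refine tendsto_integral_of_dominated_convergence _
      (fun m => (hX.integrable_ridgeInv (hpos m) j k).1)
      ((hX.integrable_inv_gram_apply_self hnp j).add (hX.integrable_inv_gram_apply_self hnp k))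
      (fun m => ?_) ?_
    · filter_upwards [hunit] with ω hω
      exact (abs_ridgeInv_apply_le (hpos m) j k).trans
        (add_le_add (ridgeInv_apply_self_le (hpos m) hω j)
          (ridgeInv_apply_self_le (hpos m) hω k))
    · filter_upwards [hunit] with ω hω
      exact ((continuous_id.matrix_elem j k).tendsto _).comp
        (tendsto_ridgeInv_apply hω tendsto_one_div_add_atTop_nhds_zero_nat)
  have l2 : ∀ i j k, Tendsto (fun m : ℕ => ∫ ω, (X ω i j - M i j) *
      (X ω * ridgeInv (1 / ((m : ℝ) + 1)) (X ω)) i k ∂P) atTop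
      (𝓝 (∫ ω, (X ω i j - M i j) * (X ω * ((X ω)ᵀ * X ω)⁻¹) i k ∂P)) := by
    intro i j k
    refine tendsto_integral_of_dominated_convergence _
      (fun m => (hX.integrable_sub_mul_ridgeInv (hpos m) i j k).1)
      (hX.integrable_sub_sq_add_inv_gram hnp i j k) (fun m => ?_) ?_
    · filter_upwards [hunit] with ω hω
      exact (abs_mul_le_sq_add_sq _ _).trans (add_le_add_right
        ((sq_mul_ridgeInv_apply_le (hpos m) (X ω) i k).trans
          (ridgeInv_apply_self_le (hpos m) hω k)) _)
    · filter_upwards [hunit] with ω hω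
      have hc : Continuous (fun A : Matrix (Fin p) (Fin p) ℝ => (X ω i j - M i j) *
          (X ω * A) i k) :=
        continuous_const.mul ((continuous_const.matrix_mul continuous_id).matrix_elem i k)
      exact (hc.tendsto _).comp (tendsto_ridgeInv_apply hω tendsto_one_div_add_atTop_nhds_zero_nat)
  have h := fun m : ℕ => hX.integral_trace_ridgeInv_le (hpos m) hQ
  simp only [fun m : ℕ => integral_sum_const_mul (hX.integrable_sub_mul_ridgeInv (hpos m)) Q,
    fun m : ℕ => integral_trace_mul (hX.integrable_ridgeInv (hpos m)) Q] at h
  rw [integral_sum_const_mul (hX.integrable_sub_mul_inv_gram hnp),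
    integral_trace_mul (hX.integrable_inv_gram hnp)]
  refine le_of_tendsto_of_tendsto' (b := atTop) (Tendsto.const_mul _ ?_) ?_ h
  · simp only [Matrix.trace, Matrix.diag, Matrix.mul_apply, Matrix.of_apply]
    exact tendsto_finsetSum _ fun j _ => tendsto_finsetSum _ fun k _ => (l1 k j).const_mul _
  · exact tendsto_finsetSum _ fun i _ => tendsto_finsetSum _ fun j _ =>
      tendsto_finsetSum _ fun k _ => (l2 i j k).const_mul _

end IsGaussianMatrix

/-! ### Algebra of the two losses. -/

section Loss

variable {n p : ℕ}

theorem trace_mul_mul_transpose_eq_sum (Q : Matrix (Fin p) (Fin p) ℝ)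
    (Z W : Matrix (Fin n) (Fin p) ℝ) :
    (Z * Q * Wᵀ).trace = ∑ i, ∑ j, ∑ k, Q j k * (Z i j * W i k) := by
  simp only [Matrix.trace, Matrix.diag, Matrix.mul_apply, Matrix.transpose_apply, Finset.sum_mul]
  refine Finset.sum_congr rfl fun i _ => ?_
  rw [Finset.sum_comm]
  exact Finset.sum_congr rfl fun j _ => Finset.sum_congr rfl fun k _ => by ring

theorem trace_mul_mul_transpose_self (Q : Matrix (Fin p) (Fin p) ℝ)
    (Z : Matrix (Fin n) (Fin p) ℝ) : (Z * Q * Zᵀ).trace = (Q * (Zᵀ * Z)).trace := by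
  rw [Matrix.mul_assoc, Matrix.trace_mul_comm, Matrix.mul_assoc]

theorem trace_add_mul_mul_transpose_add {Q : Matrix (Fin p) (Fin p) ℝ} (hQ : Qᵀ = Q)
    (Z W : Matrix (Fin n) (Fin p) ℝ) :
    ((Z + W) * Q * (Z + W)ᵀ).trace =
      (Z * Q * Zᵀ).trace + 2 * (Z * Q * Wᵀ).trace + (W * Q * Wᵀ).trace := by
  have h : (W * Q * Zᵀ).trace = (Z * Q * Wᵀ).trace := by
    rw [← Matrix.trace_transpose]
    simp only [Matrix.transpose_mul, Matrix.transpose_transpose, hQ, Matrix.mul_assoc]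
  rw [Matrix.transpose_add, Matrix.add_mul, Matrix.add_mul, Matrix.mul_add, Matrix.mul_add,
    Matrix.trace_add, Matrix.trace_add, Matrix.trace_add, h]
  ring

theorem quadraticLoss_efronMorris {Q : Matrix (Fin p) (Fin p) ℝ} (hQ : Qᵀ = Q)
    (M X : Matrix (Fin n) (Fin p) ℝ) :
    quadraticLoss Q M (efronMorris X) = (Q * ((X - M)ᵀ * (X - M))).trace -
      2 * ((n : ℝ) - p - 1) * (∑ i, ∑ j, ∑ k, Q j k *
        ((X i j - M i j) * (X * (Xᵀ * X)⁻¹) i k)) +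
      ((n : ℝ) - p - 1) ^ 2 * (Q * (Xᵀ * X)⁻¹).trace := by
  set c := (n : ℝ) - p - 1 with hc
  have e : efronMorris X - M = (X - M) + (-c) • (X * (Xᵀ * X)⁻¹) := by
    rw [efronMorris, ← hc, Matrix.mul_sub, Matrix.mul_one, Matrix.mul_smul, neg_smul]
    abel
  have h := trace_mul_mul_transpose_eq_sum Q (X - M) (X * (Xᵀ * X)⁻¹)
  simp only [Matrix.sub_apply] at h
  rw [quadraticLoss, e, trace_add_mul_mul_transpose_add hQ, trace_mul_mul_transpose_self, ← h,
    trace_mul_mul_transpose_self, Matrix.transpose_smul, Matrix.mul_smul, Matrix.smul_mul,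
    Matrix.mul_smul, Matrix.mul_smul, inv_gram_eq]
  simp only [Matrix.mul_smul, Matrix.trace_smul, smul_eq_mul]
  ring

theorem oracleCoeff_eq (hn : 0 < n) (M : Matrix (Fin n) (Fin p) ℝ) :
    oracleCoeff M = 1 - (n : ℝ) • ridgeInv (n : ℝ) M := by
  have h := congrArg Matrix.transpose (gram_mul_ridgeInv (Nat.cast_pos.2 hn) M)
  simp only [Matrix.transpose_mul, transpose_ridgeInv, Matrix.transpose_transpose,
    Matrix.transpose_sub, Matrix.transpose_one, Matrix.transpose_smul] at h
  exact h

/-- Bias plus variance of the linear oracle. -/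
theorem oracle_bias_add_variance (hn : 0 < n) (M : Matrix (Fin n) (Fin p) ℝ)
    (Q : Matrix (Fin p) (Fin p) ℝ) :
    (n : ℝ) * (oracleCoeff M * Q * (oracleCoeff M)ᵀ).trace +
      ((M * oracleCoeff M - M) * Q * (M * oracleCoeff M - M)ᵀ).trace =
      n * Q.trace - (n : ℝ) ^ 2 * (Q * ridgeInv (n : ℝ) M).trace := by
  have hn' : (0 : ℝ) < n := Nat.cast_pos.2 hn
  have hG := ridgeInv_mul_gram_mul hn' M
  have ht := transpose_ridgeInv (n : ℝ) M
  rw [oracleCoeff_eq hn]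
  set B := ridgeInv (n : ℝ) M
  have e1 : M * (1 - (n : ℝ) • B) - M = (-(n : ℝ)) • (M * B) := by
    rw [Matrix.mul_sub, Matrix.mul_one, Matrix.mul_smul, neg_smul]; abel
  have e2 : (1 - (n : ℝ) • B)ᵀ * (1 - (n : ℝ) • B) =
      1 - (2 * n : ℝ) • B + ((n : ℝ) ^ 2) • (B * B) := by
    rw [Matrix.transpose_sub, Matrix.transpose_smul, ht, Matrix.transpose_one]
    simp only [Matrix.sub_mul, Matrix.mul_sub, Matrix.one_mul, Matrix.mul_one, Matrix.smul_mul,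
      Matrix.mul_smul]
    module
  rw [e1, trace_mul_mul_transpose_self, trace_mul_mul_transpose_self, e2, Matrix.transpose_smul,
    Matrix.mul_smul, Matrix.smul_mul, hG]
  simp only [Matrix.mul_add, Matrix.mul_sub, Matrix.mul_one, Matrix.mul_smul, Matrix.trace_add,
    Matrix.trace_sub, Matrix.trace_smul, smul_eq_mul]
  -- With `C = I - n B`, the variance `n tr(Q Cᵀ C)` and the squared bias `n² tr(Q (B - n B²))` have
  -- cancelling `B²` terms.
  ring

/-- Follows from `I - ε G = ε (X G)ᵀ (X G) + (I - ε G)ᵀ (I - ε G)`. -/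
theorem mul_trace_mul_ridgeInv_le {ε : ℝ} (hε : 0 < ε) {Q : Matrix (Fin p) (Fin p) ℝ}
    (hQ : Q.PosSemidef) (X : Matrix (Fin n) (Fin p) ℝ) :
    ε * (Q * ridgeInv ε X).trace ≤ Q.trace := by
  have h1 := trace_mul_transpose_mul_self_nonneg hQ (X * ridgeInv ε X)
  have h2 := trace_mul_transpose_mul_self_nonneg hQ (1 - ε • ridgeInv ε X)
  rw [ridgeInv_mul_gram_mul hε, Matrix.mul_sub, Matrix.trace_sub, Matrix.mul_smul,
    Matrix.trace_smul, smul_eq_mul] at h1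
  have e2 : (1 - ε • ridgeInv ε X)ᵀ * (1 - ε • ridgeInv ε X) =
      1 - (2 * ε) • ridgeInv ε X + (ε ^ 2) • (ridgeInv ε X * ridgeInv ε X) := by
    rw [Matrix.transpose_sub, Matrix.transpose_smul, transpose_ridgeInv, Matrix.transpose_one]
    simp only [Matrix.sub_mul, Matrix.mul_sub, Matrix.one_mul, Matrix.mul_one, Matrix.smul_mul,
      Matrix.mul_smul]
    module
  rw [e2] at h2
  simp only [Matrix.mul_add, Matrix.mul_sub, Matrix.mul_one, Matrix.mul_smul, Matrix.trace_add,
    Matrix.trace_sub, Matrix.trace_smul, smul_eq_mul] at h2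
  have := mul_nonneg hε.le h1
  nlinarith

end Loss

/-! ### Risk bounds and the comparison. -/

namespace IsGaussianMatrix

variable {Ω : Type*} [MeasurableSpace Ω] {P : Measure Ω} [IsProbabilityMeasure P] {n p : ℕ}
  {X : Ω → Matrix (Fin n) (Fin p) ℝ} {M : Matrix (Fin n) (Fin p) ℝ}

theorem integrable_centered_gram (hX : IsGaussianMatrix X M P) (j k : Fin p) :
    Integrable (fun ω => ((X ω - M)ᵀ * (X ω - M)) j k) P := by
  simp only [Matrix.mul_apply, Matrix.transpose_apply, Matrix.sub_apply]
  exact integrable_finsetSum _ fun i _ => hX.integrable_entry_sub_mul i i j k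

theorem integral_centered_gram (hX : IsGaussianMatrix X M P) :
    (Matrix.of fun j k => ∫ ω, ((X ω - M)ᵀ * (X ω - M)) j k ∂P) =
      (n : ℝ) • (1 : Matrix (Fin p) (Fin p) ℝ) := by
  ext j k
  simp only [Matrix.mul_apply, Matrix.transpose_apply, Matrix.sub_apply, Matrix.of_apply]
  rw [integral_finsetSum _ fun i _ => hX.integrable_entry_sub_mul i i j k]
  simp [hX.integral_entry_sub_mul]

theorem integral_gram (hX : IsGaussianMatrix X M P) :
    (Matrix.of fun j k => ∫ ω, ((X ω)ᵀ * X ω) j k ∂P) =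
      Mᵀ * M + (n : ℝ) • (1 : Matrix (Fin p) (Fin p) ℝ) := by
  ext j k
  have e : ∀ i, ∫ ω, X ω i j * X ω i k ∂P =
      (1 : Matrix (Fin p) (Fin p) ℝ) j k + M i j * M i k := by
    intro i
    have e1 : ∀ ω, X ω i j * X ω i k = (X ω i j - M i j) * (X ω i k - M i k) +
        (M i k * (X ω i j - M i j) + M i j * (X ω i k - M i k) + M i j * M i k) := fun ω => by ring
    have a := (hX.integrable_entry_sub i j).const_mul (M i k)
    have b := (hX.integrable_entry_sub i k).const_mul (M i j)
    have ab : Integrable (fun ω => M i k * (X ω i j - M i j) + M i j * (X ω i k - M i k)) P :=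
      a.add b
    have abc : Integrable (fun ω => M i k * (X ω i j - M i j) + M i j * (X ω i k - M i k) +
        M i j * M i k) P := ab.add (integrable_const _)
    simp_rw [e1]
    rw [integral_add (hX.integrable_entry_sub_mul i i j k) abc,
      integral_add ab (integrable_const _), integral_add a b, integral_const_mul,
      integral_const_mul, hX.integral_entry_sub, hX.integral_entry_sub, hX.integral_entry_sub_mul]
    simp
  simp only [Matrix.mul_apply, Matrix.transpose_apply, Matrix.of_apply, Matrix.add_apply,
    Matrix.smul_apply]
  rw [integral_finsetSum _ fun i _ => hX.integrable_entry_mul i j k]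
  simp only [e, Finset.sum_add_distrib]
  simp [add_comm]

theorem integrable_quadraticLoss_efronMorris (hX : IsGaussianMatrix X M P) (hnp : p + 1 < n)
    {Q : Matrix (Fin p) (Fin p) ℝ} (hQ : Qᵀ = Q) :
    Integrable (fun ω => quadraticLoss Q M (efronMorris (X ω))) P := by
  simp_rw [quadraticLoss_efronMorris hQ]
  exact ((integrable_trace_mul hX.integrable_centered_gram Q).sub
    ((integrable_sum_const_mul (hX.integrable_sub_mul_inv_gram hnp) Q).const_mul _)).add
    ((integrable_trace_mul (hX.integrable_inv_gram hnp) Q).const_mul _)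

theorem integral_quadraticLoss_efronMorris_le (hX : IsGaussianMatrix X M P) (hnp : p + 1 < n)
    {Q : Matrix (Fin p) (Fin p) ℝ} (hQ : Q.PosSemidef) (hQt : Qᵀ = Q) :
    ∫ ω, quadraticLoss Q M (efronMorris (X ω)) ∂P ≤
      n * Q.trace - ((n : ℝ) - p - 1) ^ 2 * ∫ ω, (Q * ((X ω)ᵀ * X ω)⁻¹).trace ∂P := by
  have hc : 0 < (n : ℝ) - p - 1 := by
    have : (p : ℝ) + 1 < n := by exact_mod_cast hnp
    linarith
  have h1 := integrable_trace_mul hX.integrable_centered_gram Q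
  have h2 := (integrable_sum_const_mul (hX.integrable_sub_mul_inv_gram hnp) Q).const_mul
    (2 * ((n : ℝ) - p - 1))
  have h3 := (integrable_trace_mul (hX.integrable_inv_gram hnp) Q).const_mul
    (((n : ℝ) - p - 1) ^ 2)
  have h12 : Integrable (fun ω => (Q * ((X ω - M)ᵀ * (X ω - M))).trace -
      2 * ((n : ℝ) - p - 1) * ∑ i, ∑ j, ∑ k, Q j k *
        ((X ω i j - M i j) * (X ω * ((X ω)ᵀ * X ω)⁻¹) i k)) P := h1.sub h2
  simp_rw [quadraticLoss_efronMorris hQt]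
  rw [integral_add h12 h3, integral_sub h1 h2, integral_const_mul, integral_const_mul,
    integral_trace_mul hX.integrable_centered_gram, hX.integral_centered_gram, Matrix.mul_smul,
    Matrix.mul_one, Matrix.trace_smul, smul_eq_mul]
  -- The cross term contributes at most `-2 c² E tr(Q S⁻¹)` and the square `+c² E tr(Q S⁻¹)`, which
  -- leaves `-c²`.
  have h4 := mul_le_mul_of_nonneg_left (hX.integral_trace_inv_gram_le hnp hQ) hc.le
  nlinarith

/-- Jensen's inequality for the matrix inverse at the Gram matrix. -/
theorem trace_mul_ridgeInv_mean_le (hX : IsGaussianMatrix X M P) (hnp : p + 1 < n)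
    {Q : Matrix (Fin p) (Fin p) ℝ} (hQ : Q.PosSemidef) :
    (Q * ridgeInv (n : ℝ) M).trace ≤ ∫ ω, (Q * ((X ω)ᵀ * X ω)⁻¹).trace ∂P := by
  have hn : (0 : ℝ) < n := Nat.cast_pos.2 (by omega)
  set B := ridgeInv (n : ℝ) M with hB
  have hI := integrable_trace_mul hX.integrable_gram (B * Q * B)
  have hcyc : ∀ S : Matrix (Fin p) (Fin p) ℝ,
      (Q * (B * S * B)).trace = (B * Q * B * S).trace := by
    intro S
    rw [← Matrix.mul_assoc, Matrix.trace_mul_comm]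
    simp only [Matrix.mul_assoc]
  -- The tangent is taken at the mean: `B` inverts `E S`, so `B (E S) B = B`.
  have hmean : ∫ ω, (B * Q * B * ((X ω)ᵀ * X ω)).trace ∂P = (Q * B).trace := by
    rw [integral_trace_mul hX.integrable_gram, hX.integral_gram, ← hcyc, hB, ridgeInv,
      Matrix.nonsing_inv_mul _ (isUnit_det_gram_add_smul_one hn M), Matrix.one_mul]
  have h : ∫ ω, (2 * (Q * B).trace - (B * Q * B * ((X ω)ᵀ * X ω)).trace) ∂P ≤
      ∫ ω, (Q * ((X ω)ᵀ * X ω)⁻¹).trace ∂P := by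
    refine integral_mono_ae ((integrable_const _).sub hI)
      (integrable_trace_mul (hX.integrable_inv_gram hnp) Q) ?_
    filter_upwards [hX.ae_isUnit_det_gram hnp] with ω hω
    have := trace_mul_inv_gram_ge hQ hω (transpose_ridgeInv (n : ℝ) M)
    rwa [← hB, hcyc] at this
  rw [integral_sub (integrable_const _) hI, hmean] at h
  simp only [integral_const, probReal_univ, one_smul] at h
  linarith

/-- The error is `(X - M) C + D` with deterministic bias `D`; the cross term is linear in the
centred noise and averages to zero. -/
theorem integrable_and_integral_quadraticLoss_linearEstimator (hX : IsGaussianMatrix X M P)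
    (C : Matrix (Fin p) (Fin p) ℝ) {Q : Matrix (Fin p) (Fin p) ℝ} (hQ : Qᵀ = Q) :
    Integrable (fun ω => quadraticLoss Q M (linearEstimator C (X ω))) P ∧
    ∫ ω, quadraticLoss Q M (linearEstimator C (X ω)) ∂P =
      n * (C * Q * Cᵀ).trace + ((M * C - M) * Q * (M * C - M)ᵀ).trace := by
  set D := M * C - M with hD
  have e : ∀ ω, quadraticLoss Q M (linearEstimator C (X ω)) =
      (C * Q * Cᵀ * ((X ω - M)ᵀ * (X ω - M))).trace +
      2 * (∑ i, ∑ j, (C * Q * Dᵀ) j i * (X ω i j - M i j)) + (D * Q * Dᵀ).trace := by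
    intro ω
    have e1 : X ω * C - M = (X ω - M) * C + D := by rw [hD, Matrix.sub_mul]; abel
    rw [quadraticLoss, linearEstimator, e1, trace_add_mul_mul_transpose_add hQ]
    congr 2
    · rw [← trace_mul_mul_transpose_self, Matrix.transpose_mul]
      simp only [Matrix.mul_assoc]
    · rw [Matrix.mul_assoc, Matrix.mul_assoc, ← Matrix.mul_assoc C]
      simp only [Matrix.trace, Matrix.diag, Matrix.mul_apply (M := X ω - M), Matrix.sub_apply]
      simp only [mul_comm]
  have h1 := integrable_trace_mul hX.integrable_centered_gram (C * Q * Cᵀ)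
  have h2 : ∀ i j, Integrable (fun ω => (C * Q * Dᵀ) j i * (X ω i j - M i j)) P :=
    fun i j => (hX.integrable_entry_sub i j).const_mul _
  have h3 : Integrable (fun ω => 2 * ∑ i, ∑ j, (C * Q * Dᵀ) j i * (X ω i j - M i j)) P :=
    (integrable_finsetSum _ fun i _ => integrable_finsetSum _ fun j _ => h2 i j).const_mul _
  have h13 : Integrable (fun ω => (C * Q * Cᵀ * ((X ω - M)ᵀ * (X ω - M))).trace +
      2 * (∑ i, ∑ j, (C * Q * Dᵀ) j i * (X ω i j - M i j))) P := h1.add h3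
  simp_rw [e]
  refine ⟨h13.add (integrable_const _), ?_⟩
  rw [integral_add h13 (integrable_const _), integral_add h1 h3, integral_const_mul,
    integral_trace_mul hX.integrable_centered_gram, hX.integral_centered_gram,
    integral_finsetSum _ fun i _ => integrable_finsetSum _ fun j _ => h2 i j,
    Finset.sum_eq_zero fun i _ => ?_]
  · simp
  · rw [integral_finsetSum _ fun j _ => h2 i j]
    refine Finset.sum_eq_zero fun j _ => ?_
    rw [integral_const_mul, hX.integral_entry_sub, mul_zero]

end IsGaussianMatrix

theorem mainTheorem4 {Ω : Type*} [MeasurableSpace Ω] (P : Measure Ω) [IsProbabilityMeasure P]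
    {n p : ℕ} (hnp : p + 1 < n) (M : Matrix (Fin n) (Fin p) ℝ)
    (X : Ω → Matrix (Fin n) (Fin p) ℝ) (hX : IsGaussianMatrix X M P)
    (Q : Matrix (Fin p) (Fin p) ℝ) (hQ : Q.PosDef) :
    Integrable (fun ω => quadraticLoss Q M (efronMorris (X ω))) P ∧
    Integrable (fun ω => quadraticLoss Q M (linearEstimator (oracleCoeff M) (X ω))) P ∧
    ∫ ω, quadraticLoss Q M (efronMorris (X ω)) ∂P ≤
      ∫ ω, quadraticLoss Q M (linearEstimator (oracleCoeff M) (X ω)) ∂P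
        + 2 * ((p : ℝ) + 1) * Q.trace := by
  have hQs : Q.PosSemidef := hQ.posSemidef
  have hQt : Qᵀ = Q := by
    have := hQ.1.eq
    rwa [Matrix.conjTranspose_eq_transpose_of_trivial] at this
  have hn : 0 < n := by omega
  have hn' : (0 : ℝ) < n := Nat.cast_pos.2 hn
  obtain ⟨hI, hE⟩ :=
    hX.integrable_and_integral_quadraticLoss_linearEstimator (oracleCoeff M) hQt
  refine ⟨hX.integrable_quadraticLoss_efronMorris hnp hQt, hI, ?_⟩
  rw [hE, oracle_bias_add_variance hn]
  refine (hX.integral_quadraticLoss_efronMorris_le hnp hQs hQt).trans ?_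
  have h1 := mul_le_mul_of_nonneg_left (hX.trace_mul_ridgeInv_mean_le hnp hQs)
    (sq_nonneg ((n : ℝ) - p - 1))
  have h2 := mul_le_mul_of_nonneg_left (mul_trace_mul_ridgeInv_le hn' hQs M)
    (by positivity : (0 : ℝ) ≤ 2 * ((p : ℝ) + 1))
  have h3 := trace_mul_ridgeInv_nonneg hn' hQs M
  -- Here `n² - c² = 2 n (p + 1) - (p + 1)²`; `h2` handles the first term and `h4` discards the
  -- second.
  have h4 := mul_nonneg (sq_nonneg ((p : ℝ) + 1)) h3
  nlinarith
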